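/- Fix $\alpha\in(0,1)$ and $\overline a<1$, and let $\mathbb A_0=\{(a_1,a_2)\in[0,1]^2: a_1+a_2\le\overline a\}$. For $|\rho|\le 1$ put $$q_{a_1,a_2,\rho}(x,y)=a_1x^2+a_2\bigl(\rho x+\sqrt{1-\rho^2}\,y\bigr)^2+(1-a_1-a_2)y^2,$$ let $\mathbb C_\alpha(a_1,a_2;\rho)$ be the $(1-\alpha)$-quantile of $q_{a_1,a_2,\rho}(\mathcal Z_1,\mathcal Z_2)$ for independent standard normal $\mathcal Z_1,\mathcal Z_2$, and let $\mathbb C_{\alpha,\max}(\rho)=\sup_{(a_1,a_2)\in\mathbb A_0}\mathbb C_\alpha(a_1,a_2;\rho)$. The linear combination test is $\phi_{a_1,a_2,\infty}=1\{q_{a_1,a_2,\rho}(\mathcal N_1,\mathcal N_2^*)\ge\mathbb C_\alpha(a_1,a_2;\rho)\}$. Tests may be randomized, i.e. they are measurable functions of the observations with values in $[0,1]$. **(i) Weak identification, fixed alternatives.** Let $\Phi_1(\beta_0)>0$, $\Psi(\beta_0)>0$, $\rho=\Phi_{12}(\beta_0)/\sqrt{\Phi_1(\beta_0)\Psi(\beta_0)}\in(-1,1)$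 and $(a_1,a_2)\in\mathbb A_0$. Let $\mathcal N_1\sim N(\theta_1,1)$ and $\mathcal N_2^*\sim N(\theta_2,1)$ be independent, and let $$\begin{pmatrix}a_1+a_2\rho^2&a_2\rho\sqrt{1-\rho^2}\\a_2\rho\sqrt{1-\rho^2}&1-a_1-a_2\rho^2\end{pmatrix}=\mathcal U\begin{pmatrix}\nu_1&0\\0&\nu_2\end{pmatrix}\mathcal U^\top,\qquad \nu_1\ge\nu_2,\ \mathcal U\text{ orthogonal},\qquad (\widetilde{\mathcal N}_1,\widetilde{\mathcal N}_2)^\top=\mathcal U^\top(\mathcal N_1,\mathcal N_2^*)^\top .$$ Let $\Phi_\alpha$ be the class of tests that are functions of $(\widetilde{\mathcal N}_1^2,\widetilde{\mathcal N}_2^2)$ and have rejection probability at most $\alpha$ under $H_0:\theta_1=\theta_2=0$. Then $\phi_{a_1,a_2,\infty}$ has size exactly $\alpha$ and is admissible within $\Phi_\alpha$: it belongs to $\Phi_\alpha$, and no $\phi\in\Phi_\alpha$ has at least its power at every alternative and strictly more at some alternative. This holds when the alternatives are all $(\theta_1,\theta_2)\ne(0,0)$, and also when they are all the pairs $(\theta_1,\theta_2)=(m_1(\Delta),m_2(\Delta))$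 with $\Delta\neq 0$, $\widetilde{\mathcal C}\ne0$, where $$m_1(\Delta)=\frac{\Delta^2\widetilde{\mathcal C}}{\Phi_1(\beta_0)^{1/2}},\qquad m_2(\Delta)=\frac{1}{\sqrt{1-\rho^2}}\left(\frac{\Delta\widetilde{\mathcal C}}{\Psi(\beta_0)^{1/2}}-\frac{\rho\,\Delta^2\widetilde{\mathcal C}}{\Phi_1(\beta_0)^{1/2}}\right).$$ In addition, for every $\phi\in\Phi_\alpha$ there is $\overline b>0$ such that for all $0<b<\overline b$ and all $(\theta_1,\theta_2)$ for which $(\widetilde\theta_1,\widetilde\theta_2)=(\theta_1,\theta_2)\,\mathcal U$ satisfies $(\widetilde\theta_1^2,\widetilde\theta_2^2)=b\,(\nu_1,\nu_2)$, one has $\mathbb E\phi\le\mathbb E\phi_{a_1,a_2,\infty}$. **(ii) Strong identification, local alternatives.** Let $|\rho|<1$, $(a_1,a_2)\in\mathbb A_0$, let $(\mathcal N_1,\mathcal N_2)$ be bivariate normal with means $(0,\theta)$, unit variances and correlation $\rho$, and let $\mathcal N_2^*=(1-\rho^2)^{-1/2}(\mathcal N_2-\rho\mathcal N_1)$. Consider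 $H_0:\theta=0$ against $H_1:\theta\ne0$. Each of the following holds if and only if $a_1=0$ and $a_2\rho=0$: $\phi_{a_1,a_2,\infty}$ is UMP among the level-$\alpha$ tests based on $(\mathcal N_1,\mathcal N_2)$ that are invariant under the sign change $(\mathcal N_1,\mathcal N_2^*)\mapsto(\mathcal N_1,-\mathcal N_2^*)$; at every $\theta\neq0$ it has at least the power of every test in that class (whether or not it belongs to the class itself); it is UMP among the level-$\alpha$ tests based on $(\mathcal N_1,\mathcal N_2)$ that are invariant under the sign change $(\mathcal N_1,\mathcal N_2)\mapsto(-\mathcal N_1,-\mathcal N_2)$; it is UMP among the unbiased level-$\alpha$ tests based on $(\mathcal N_1,\mathcal N_2)$. **(iii) Strong identification, fixed alternatives.** For each sample size $n$ let $Y_i=X_i\beta+e_i$, $i=1,\dots,n$, with $X_i,e_i$ integrable, $\mathbb E e_i=0$, $\Pi_i=\mathbb E X_i$, a fixed $n\times K$ matrix $Z$ of instruments of full column rank, $P=Z(Z^\top Z)^{-1}Z^\top$, $Q_{a,b}=K^{-1/2}\sum_i\sum_{j\ne i}a_iP_{ij}b_j$ and $\mathcal C=Q_{\Pi,\Pi}$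 (the dependence of all these on $n$ is suppressed; $\beta$ is fixed). Let $\Phi_1,\Phi_{12},\Phi_{13},\Psi,\tau,\Upsilon$ be constants. For a hypothesized value $b$ put $\Delta=\beta-b$, $e_i(b)=Y_i-X_ib$ and $$\begin{aligned}\Phi_1(b)&=\Delta^4\Upsilon+4\Delta^3\tau+\Delta^2(4\Psi+2\Phi_{13})+4\Delta\Phi_{12}+\Phi_1, & \Phi_{12}(b)&=\Delta^3\Upsilon+3\Delta^2\tau+\Delta(2\Psi+\Phi_{13})+\Phi_{12},\\ \Phi_{13}(b)&=\Delta^2\Upsilon+2\Delta\tau+\Phi_{13},\qquad \Psi(b)=\Delta^2\Upsilon+2\Delta\tau+\Psi, & \tau(b)&=\Delta\Upsilon+\tau,\qquad \rho(b)=\frac{\Phi_{12}(b)}{\sqrt{\Phi_1(b)\Psi(b)}},\end{aligned}$$ $\gamma(b)=(\Phi_1(b),\Phi_{12}(b),\Phi_{13}(b),\Psi(b),\tau(b),\Upsilon,\rho(b))$. Suppose that over a compact set $\mathcal B\ni\beta_0$ one has $\inf_{b\in\mathcal B}\Phi_1(b)>0$, $\inf_{b\in\mathcal B}\Psi(b)>0$,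 $\Upsilon>0$, and $\|\widehat\gamma(b)-\gamma(b)\|_2=o_p(1)$ for every $b\in\mathcal B$, where $\widehat\gamma(b)=(\widehat\Phi_1(b),\widehat\Phi_{12}(b),\widehat\Phi_{13}(b),\widehat\Psi(b),\widehat\tau(b),\widehat\Upsilon,\widehat\rho(b))$ are estimators; that, with $\Delta=\beta-\beta_0$, the vector $(Q_{e(\beta_0),e(\beta_0)}-\Delta^2\mathcal C,\ Q_{X,e(\beta_0)}-\Delta\mathcal C,\ Q_{X,X}-\mathcal C)$ is $O_p(1)$; that $|\mathcal C|\to\infty$; that $\Delta\ne0$ is fixed; and that $|\rho(\beta_0)|<1$. Let $$AR=\frac{Q_{e(\beta_0),e(\beta_0)}}{\widehat\Phi_1(\beta_0)^{1/2}},\qquad LM=\frac{Q_{X,e(\beta_0)}}{\widehat\Psi(\beta_0)^{1/2}},\qquad LM^*=\frac{LM-\widehat\rho(\beta_0)AR}{(1-\widehat\rho(\beta_0)^2)^{1/2}},\qquad \Delta_*(\beta_0)=\frac{\Phi_1(\beta_0)^{1/2}}{\Psi(\beta_0)^{1/2}\rho(\beta_0)} .$$ If the (possibly data-dependent) weights satisfy,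 for all large $n$, $(a_{1,n},a_{2,n})\in\mathbb A_0$ and $$1\ge a_{1,n}\ge\frac{\tilde q\,\Phi_1(\beta_0)}{\mathcal C^2\Delta_*^4(\beta_0)}\qquad\text{for some constant }\tilde q>\mathbb C_{\alpha,\max}(\rho(\beta_0))$$ (the lower bound is read as $0$ when $\rho(\beta_0)=0$), then $$1\bigl\{a_{1,n}AR^2+a_{2,n}LM^2+(1-a_{1,n}-a_{2,n})LM^{*2}\ge\mathbb C_\alpha(a_{1,n},a_{2,n};\widehat\rho(\beta_0))\bigr\}\ \xrightarrow{\ p\ }\ 1 .$$ -/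

import Mathlib

open MeasureTheory ProbabilityTheory Filter Topology Matrix

noncomputable section

namespace JackknifeCLC

/-! ### Tests, power, optimality -/

/-- A (possibly randomized) test based on a pair of real observations: the value at an observation
is the probability of rejecting the null hypothesis. -/
def IsTest (φ : ℝ × ℝ → ℝ) : Prop :=
  Measurable φ ∧ ∀ z, 0 ≤ φ z ∧ φ z ≤ 1

/-- The rejection probability of a test when the pair of observations has law `P`. -/
def power (P : Measure (ℝ × ℝ)) (φ : ℝ × ℝ → ℝ) : ℝ := ∫ z, φ z ∂P

/-- `φ` is admissible within the class `T` of tests, against the set `alt` of alternatives: it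
belongs to `T`, and no member of `T` has at least its power at every alternative and strictly more
power at some alternative. -/
def IsAdmissibleIn {ι : Type*} (T : Set (ℝ × ℝ → ℝ)) (law : ι → Measure (ℝ × ℝ)) (alt : Set ι)
    (φ : ℝ × ℝ → ℝ) : Prop :=
  φ ∈ T ∧ ¬ ∃ ψ ∈ T, (∀ θ ∈ alt, power (law θ) φ ≤ power (law θ) ψ) ∧
    ∃ θ ∈ alt, power (law θ) φ < power (law θ) ψ

/-- At each alternative in `alt`, the power of `φ` is at least that of every member of `T`. -/
def PowerDominates {ι : Type*} (T : Set (ℝ × ℝ → ℝ)) (law : ι → Measure (ℝ × ℝ)) (alt : Set ι)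
    (φ : ℝ × ℝ → ℝ) : Prop :=
  ∀ ψ ∈ T, ∀ θ ∈ alt, power (law θ) ψ ≤ power (law θ) φ

/-- `φ` is uniformly most powerful within the class `T` against the alternatives `alt`. -/
def IsUMPIn {ι : Type*} (T : Set (ℝ × ℝ → ℝ)) (law : ι → Measure (ℝ × ℝ)) (alt : Set ι)
    (φ : ℝ × ℝ → ℝ) : Prop :=
  φ ∈ T ∧ PowerDominates T law alt φ

/-! ### The linear combination test of the limit experiment -/

/-- Joint law of two independent normal variables with unit variances and means `θ.1`, `θ.2`. -/
def gaussPair (θ : ℝ × ℝ) : Measure (ℝ × ℝ) :=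
  (gaussianReal θ.1 1).prod (gaussianReal θ.2 1)

/-- The `p`-quantile of a law on the real line. -/
def quantile (P : Measure ℝ) (p : ℝ) : ℝ := sInf {x : ℝ | p ≤ P.real (Set.Iic x)}

/-- `a₁ x² + a₂ (ρ x + √(1-ρ²) y)² + (1 - a₁ - a₂) y²`, at weights `a` and observations
`(x, y)`. -/
def combStat (a : ℝ × ℝ) (ρ : ℝ) (z : ℝ × ℝ) : ℝ :=
  a.1 * z.1 ^ 2 + a.2 * (ρ * z.1 + √(1 - ρ ^ 2) * z.2) ^ 2 + (1 - a.1 - a.2) * z.2 ^ 2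

/-- The `(1-α)`-quantile of the combined statistic of two independent standard normals. -/
def critVal (α : ℝ) (a : ℝ × ℝ) (ρ : ℝ) : ℝ :=
  quantile ((gaussPair 0).map (combStat a ρ)) (1 - α)

/-- The linear combination test, as a function of the independent normals
`z = (N₁, N₂*)`. -/
def combTest (α : ℝ) (a : ℝ × ℝ) (ρ : ℝ) : ℝ × ℝ → ℝ :=
  Set.indicator {z | critVal α a ρ ≤ combStat a ρ z} 1

/-- The admitted weights: `a₁, a₂ ∈ [0,1]` and `a₁ + a₂ ≤ abar`. -/
def weightSet (abar : ℝ) : Set (ℝ × ℝ) :=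
  {a | a.1 ∈ Set.Icc (0 : ℝ) 1 ∧ a.2 ∈ Set.Icc (0 : ℝ) 1 ∧ a.1 + a.2 ≤ abar}

/-- The largest critical value over the admitted weights. -/
def critMax (α abar ρ : ℝ) : ℝ := sSup ((fun a => critVal α a ρ) '' weightSet abar)

/-- The matrix of the quadratic form `combStat a ρ`. -/
def weightMatrix (a : ℝ × ℝ) (ρ : ℝ) : Matrix (Fin 2) (Fin 2) ℝ :=
  !![a.1 + a.2 * ρ ^ 2, a.2 * ρ * √(1 - ρ ^ 2);
     a.2 * ρ * √(1 - ρ ^ 2), 1 - a.1 - a.2 * ρ ^ 2]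

/-- `U diag(ν₁, ν₂) Uᵀ` is an eigenvalue decomposition of the matrix of weights, with ordered
eigenvalues and orthogonal `U`. -/
structure IsEigenDecomp (a : ℝ × ℝ) (ρ : ℝ) (U : Matrix (Fin 2) (Fin 2) ℝ) (ν : Fin 2 → ℝ) :
    Prop where
  orthogonal : U ∈ Matrix.orthogonalGroup (Fin 2) ℝ
  ordered : ν 1 ≤ ν 0
  eq : weightMatrix a ρ = U * Matrix.diagonal ν * Uᵀ

/-- The rotated pair `Uᵀ z`; for a row vector this is also `z U`. -/
def rotate (U : Matrix (Fin 2) (Fin 2) ℝ) (z : ℝ × ℝ) : Fin 2 → ℝ := Uᵀ *ᵥ ![z.1, z.2]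

/-- Tests of level `α` for mean zero that are functions of the squares of the rotated pair. -/
def squareTests (U : Matrix (Fin 2) (Fin 2) ℝ) (α : ℝ) : Set (ℝ × ℝ → ℝ) :=
  {φ | (∃ f : ℝ × ℝ → ℝ, IsTest f ∧ ∀ z, φ z = f (rotate U z 0 ^ 2, rotate U z 1 ^ 2)) ∧
    power (gaussPair 0) φ ≤ α}

/-! ### The limit experiment under strong identification and local alternatives -/

/-- Joint law of `(N₁, N₂)`: bivariate normal, means `0` and `θ`, unit variances, correlation
`ρ`. -/
def localLaw (ρ θ : ℝ) : Measure (ℝ × ℝ) :=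
  (multivariateGaussian !₂[(0 : ℝ), θ] !![1, ρ; ρ, 1]).map (fun x => (x 0, x 1))

/-- `(N₁, N₂) ↦ (N₁, N₂*)` with `N₂* = (1-ρ²)^{-1/2} (N₂ - ρ N₁)`. -/
def orthogonalize (ρ : ℝ) (z : ℝ × ℝ) : ℝ × ℝ := (z.1, (√(1 - ρ ^ 2))⁻¹ * (z.2 - ρ * z.1))

/-- The linear combination test as a function of `(N₁, N₂)`. -/
def combTestLocal (α : ℝ) (a : ℝ × ℝ) (ρ : ℝ) : ℝ × ℝ → ℝ :=
  fun z => combTest α a ρ (orthogonalize ρ z)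

/-- The sign change `(N₁, N₂*) ↦ (N₁, -N₂*)`, in the coordinates `(N₁, N₂)`. -/
def flipOrth (ρ : ℝ) (z : ℝ × ℝ) : ℝ × ℝ := (z.1, 2 * ρ * z.1 - z.2)

theorem orthogonalize_flipOrth (ρ : ℝ) (z : ℝ × ℝ) :
    orthogonalize ρ (flipOrth ρ z) = ((orthogonalize ρ z).1, -(orthogonalize ρ z).2) := by
  simp only [orthogonalize, flipOrth, Prod.mk.injEq, true_and]
  ring

/-- The sign change `(N₁, N₂) ↦ (-N₁, -N₂)`. -/
def flipBoth (z : ℝ × ℝ) : ℝ × ℝ := (-z.1, -z.2)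

/-- Tests of level `α` for `θ = 0` based on `(N₁, N₂)`. -/
def levelTests (ρ α : ℝ) : Set (ℝ × ℝ → ℝ) :=
  {φ | IsTest φ ∧ power (localLaw ρ 0) φ ≤ α}

/-- Tests of level `α` based on `(N₁, N₂)` that are invariant under the map `s`. -/
def invariantTests (ρ α : ℝ) (s : ℝ × ℝ → ℝ × ℝ) : Set (ℝ × ℝ → ℝ) :=
  {φ | φ ∈ levelTests ρ α ∧ ∀ z, φ (s z) = φ z}

/-- Unbiased tests of level `α` based on `(N₁, N₂)`. -/
def unbiasedTests (ρ α : ℝ) : Set (ℝ × ℝ → ℝ) :=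
  {φ | φ ∈ levelTests ρ α ∧ ∀ θ : ℝ, θ ≠ 0 → α ≤ power (localLaw ρ θ) φ}

/-! ### Variance components -/

/-- The entries of the asymptotic covariance matrix of `(Q_{e,e}, Q_{X,e}, Q_{X,X})`. -/
structure VarComp where
  Φ1 : ℝ
  Φ12 : ℝ
  Φ13 : ℝ
  Ψ : ℝ
  τ : ℝ
  Υ : ℝ

namespace VarComp

/-- The components for `(Q_{e(β₀),e(β₀)}, Q_{X,e(β₀)}, Q_{X,X})`, where `e(β₀) = e + Δ X`. -/
def shift (v : VarComp) (Δ : ℝ) : VarComp where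
  Φ1 := Δ ^ 4 * v.Υ + 4 * Δ ^ 3 * v.τ + Δ ^ 2 * (4 * v.Ψ + 2 * v.Φ13) + 4 * Δ * v.Φ12 + v.Φ1
  Φ12 := Δ ^ 3 * v.Υ + 3 * Δ ^ 2 * v.τ + Δ * (2 * v.Ψ + v.Φ13) + v.Φ12
  Φ13 := Δ ^ 2 * v.Υ + 2 * Δ * v.τ + v.Φ13
  Ψ := Δ ^ 2 * v.Υ + 2 * Δ * v.τ + v.Ψ
  τ := Δ * v.Υ + v.τ
  Υ := v.Υ

/-- The correlation `Φ₁₂ / √(Φ₁ Ψ)`. -/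
def rho (v : VarComp) : ℝ := v.Φ12 / √(v.Φ1 * v.Ψ)

/-- `γ = (Φ₁, Φ₁₂, Φ₁₃, Ψ, τ, Υ, ρ)`. -/
def gamma (v : VarComp) : EuclideanSpace ℝ (Fin 7) :=
  !₂[v.Φ1, v.Φ12, v.Φ13, v.Ψ, v.τ, v.Υ, v.rho]

/-- `Δ_* = Φ₁^{1/2} Ψ^{-1/2} ρ^{-1}`. -/
def deltaStar (v : VarComp) : ℝ := √v.Φ1 * (√v.Ψ)⁻¹ * v.rho⁻¹

/-- The means `(m₁(Δ), m₂(Δ))` of the weak-identification limit of `(AR, LM*)` when `v` holds the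
variance components at `β₀` and `c` is the limit of the concentration parameter. -/
def weakMean (v : VarComp) (Δ c : ℝ) : ℝ × ℝ :=
  ((√v.Φ1)⁻¹ * Δ ^ 2 * c,
    (√(1 - v.rho ^ 2))⁻¹ * (√v.Ψ)⁻¹ * Δ * c
      - v.rho * (√(1 - v.rho ^ 2))⁻¹ * (√v.Φ1)⁻¹ * Δ ^ 2 * c)

end VarComp

/-! ### The instrumental variable model and its statistics -/

/-- The linear model `Y = X β + e` with `n` observations, a scalar regressor `X`, and `K`
fixed instruments (the columns of `Z`). -/
structure IVModel {Ω : Type*} [MeasurableSpace Ω] (P : Measure Ω) (n K : ℕ) (β : ℝ) where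
  Z : Matrix (Fin n) (Fin K) ℝ
  X : Fin n → Ω → ℝ
  e : Fin n → Ω → ℝ
  full_rank : IsUnit (Zᵀ * Z).det
  integrable_X : ∀ i, Integrable (X i) P
  integrable_e : ∀ i, Integrable (e i) P
  mean_e : ∀ i, ∫ ω, e i ω ∂P = 0

namespace IVModel

variable {Ω : Type*} [MeasurableSpace Ω] {P : Measure Ω} {n K : ℕ} {β : ℝ}

/-- The outcome. -/
def Y (M : IVModel P n K β) (i : Fin n) (ω : Ω) : ℝ := M.X i ω * β + M.e i ω

/-- `Π_i = E X_i`. -/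
def Pi (M : IVModel P n K β) (i : Fin n) : ℝ := ∫ ω, M.X i ω ∂P

/-- The projection matrix `Z (ZᵀZ)⁻¹ Zᵀ`. -/
def proj (M : IVModel P n K β) : Matrix (Fin n) (Fin n) ℝ := M.Z * (M.Zᵀ * M.Z)⁻¹ * M.Zᵀ

/-- `Q_{a,b} = K^{-1/2} ∑_i ∑_{j ≠ i} a_i P_{ij} b_j`. -/
def Q (M : IVModel P n K β) (a b : Fin n → ℝ) : ℝ :=
  (∑ i, ∑ j ∈ Finset.univ.erase i, a i * M.proj i j * b j) / √(K : ℝ)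

/-- The concentration parameter `Q_{Π,Π}`. -/
def conc (M : IVModel P n K β) : ℝ := M.Q M.Pi M.Pi

/-- The regressors at a sample point. -/
def Xv (M : IVModel P n K β) (ω : Ω) : Fin n → ℝ := fun i => M.X i ω

/-- `e(β₀) = Y - X β₀` at a sample point. -/
def res (M : IVModel P n K β) (β₀ : ℝ) (ω : Ω) : Fin n → ℝ := fun i => M.Y i ω - M.X i ω * β₀

/-- `AR(β₀)`, with `g` the value of the estimator of `γ(β₀)`. -/
def AR (M : IVModel P n K β) (β₀ : ℝ) (g : EuclideanSpace ℝ (Fin 7)) (ω : Ω) : ℝ :=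
  M.Q (M.res β₀ ω) (M.res β₀ ω) / √(g 0)

/-- `LM(β₀)`. -/
def LM (M : IVModel P n K β) (β₀ : ℝ) (g : EuclideanSpace ℝ (Fin 7)) (ω : Ω) : ℝ :=
  M.Q (M.Xv ω) (M.res β₀ ω) / √(g 3)

/-- The orthogonalized statistic `LM*(β₀)`. -/
def LMstar (M : IVModel P n K β) (β₀ : ℝ) (g : EuclideanSpace ℝ (Fin 7)) (ω : Ω) : ℝ :=
  (√(1 - g 6 ^ 2))⁻¹ * (M.LM β₀ g ω - g 6 * M.AR β₀ g ω)

/-- The event that the feasible linear combination test with weights `a` and estimate `g` rejects,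
`a₁ AR² + a₂ LM² + (1 - a₁ - a₂) LM*² ≥ C_α(a₁, a₂; ρ̂)`. -/
def rejectSet (M : IVModel P n K β) (α β₀ : ℝ) (g : Ω → EuclideanSpace ℝ (Fin 7))
    (a : Ω → ℝ × ℝ) : Set Ω :=
  {ω | critVal α (a ω) (g ω 6) ≤
    (a ω).1 * M.AR β₀ (g ω) ω ^ 2 + (a ω).2 * M.LM β₀ (g ω) ω ^ 2
      + (1 - (a ω).1 - (a ω).2) * M.LMstar β₀ (g ω) ω ^ 2}

/-- The vector `(Q_{e(β₀),e(β₀)} - Δ² 𝒞, Q_{X,e(β₀)} - Δ 𝒞, Q_{X,X} - 𝒞)`, `Δ = β - β₀`. -/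
def centered (M : IVModel P n K β) (β₀ : ℝ) (ω : Ω) : EuclideanSpace ℝ (Fin 3) :=
  !₂[M.Q (M.res β₀ ω) (M.res β₀ ω) - (β - β₀) ^ 2 * M.conc,
     M.Q (M.Xv ω) (M.res β₀ ω) - (β - β₀) * M.conc,
     M.Q (M.Xv ω) (M.Xv ω) - M.conc]

end IVModel

/-! ### Stochastic orders, for arrays whose probability space may change with `n` -/

section Arrays

variable {Ω : ℕ → Type*} [∀ n, MeasurableSpace (Ω n)]

/-- Convergence in probability to a constant. -/
def TendstoInProb (P : ∀ n, Measure (Ω n)) (W : ∀ n, Ω n → ℝ) (c : ℝ) : Prop :=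
  ∀ ε > 0, Tendsto (fun n => P n {ω | ε ≤ |W n ω - c|}) atTop (𝓝 0)

/-- `‖W‖ = O_p(1)`. -/
def BoundedInProb (P : ∀ n, Measure (Ω n)) {E : Type*} [Norm E] (W : ∀ n, Ω n → E) : Prop :=
  ∀ ε : ℝ, 0 < ε → ∃ B : ℝ, ∀ᶠ n in atTop, P n {ω | B < ‖W n ω‖} ≤ ENNReal.ofReal ε

/-- Over the compact parameter space `B`, the variance components are bounded away from zero and
consistently estimated; `γhat n b` is the estimator of `γ(b)` from `n` observations. -/
structure VarianceAssumption (P : ∀ n, Measure (Ω n)) (v : VarComp) (β : ℝ) (B : Set ℝ)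
    (γhat : ∀ n, ℝ → Ω n → EuclideanSpace ℝ (Fin 7)) : Prop where
  compact : IsCompact B
  pos_Φ1 : ∃ c > 0, ∀ b ∈ B, c ≤ (v.shift (β - b)).Φ1
  pos_Ψ : ∃ c > 0, ∀ b ∈ B, c ≤ (v.shift (β - b)).Ψ
  pos_Υ : 0 < v.Υ
  consistent : ∀ b ∈ B,
    TendstoInProb P (fun n ω => ‖γhat n b ω - (v.shift (β - b)).gamma‖) 0

end Arrays

end JackknifeCLC

end

open JackknifeCLC

namespace JackknifeCLC

/-! ### Gaussian pairs -/

/-! Every power is an exponential integral against the single law `gaussPair 0`, so two tests are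
compared through their difference `D`, weighted by a likelihood factor. All optimality claims are
Neyman–Pearson arguments: `D * g ≥ 0` pointwise for a suitable `g`, with equality of integrals only
if `D = 0` almost everywhere.

Weak identification. In the eigenbasis the statistic is `ν₀ w₁² + ν₁ w₂²`, and tests depending on
squares are even in each coordinate. Evenness removes the odd and mixed terms, so the exponential
integral of `D` at rotated mean `(t₁, t₂)` is `∫ D + ½ ∫ D (t₁² w₁² + t₂² w₂²)` up to fourth order.
When `tᵢ² = b νᵢ` the second-order weight is the statistic itself. Hence a competitor either has the
same power at every mean or loses strictly for all small `b` (`power_eq_or_lt_combTest`). Power is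
continuous and both sets of alternatives are dense, so a dominating competitor would also be at
least as good at those small means; admissibility follows.

Local alternatives. With zero weights the test rejects for large `N₂*²`. The average likelihood
ratio over means `±μ` is proportional to `cosh (μ y)`, increasing in `|y|`, so this test maximizes
the sum of the two powers (`power_add_power_neg_le`), which settles both invariant classes. For
unbiased tests the power has zero slope at the origin, and `exp` is compared with its chord
(`power_le_of_unbiased`). Conversely, a combined test at least as powerful as the two-sided test at
`±1` agrees with it almost everywhere, which forces the coefficient of `x²` to vanish
(`weights_of_ae_eq`).

Fixed alternatives. After division by the concentration parameter, the statistics converge. If the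
limit of `LM*` is nonzero, its weight of at least `1 - abar` makes the statistic outgrow a uniform
bound on the critical values. Otherwise `Δ = Δ_*`, and the lower bound on `a₁` makes `a₁ AR²`
asymptotically at least `q`, above all critical values at nearby correlations by compactness
(`eventually_critVal_le`). -/

instance isProbabilityMeasure_gaussPair (θ : ℝ × ℝ) : IsProbabilityMeasure (gaussPair θ) := by
  unfold gaussPair; infer_instance

theorem gaussianReal_eq_withDensity (m : ℝ) :
    gaussianReal m 1 = (gaussianReal 0 1).withDensity
      (fun x => ENNReal.ofReal (Real.exp (m * x - m ^ 2 / 2))) := by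
  rw [gaussianReal_of_var_ne_zero m one_ne_zero, gaussianReal_of_var_ne_zero 0 one_ne_zero,
    ← withDensity_mul _ (measurable_gaussianPDF 0 1) (by fun_prop)]
  congr 1
  ext x
  simp only [Pi.mul_apply, gaussianPDF, gaussianPDFReal]
  rw [← ENNReal.ofReal_mul (by positivity), mul_assoc (√_)⁻¹, ← Real.exp_add]
  congr 3
  simp only [NNReal.coe_one]
  ring

theorem gaussPair_eq_withDensity (θ : ℝ × ℝ) :
    gaussPair θ = (gaussPair 0).withDensity (fun z => ENNReal.ofReal
      (Real.exp (θ.1 * z.1 + θ.2 * z.2 - (θ.1 ^ 2 + θ.2 ^ 2) / 2))) := by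
  unfold gaussPair
  rw [gaussianReal_eq_withDensity θ.1, gaussianReal_eq_withDensity θ.2,
    prod_withDensity (by fun_prop) (by fun_prop)]
  simp only [Prod.fst_zero, Prod.snd_zero]
  congr 1
  ext z
  rw [← ENNReal.ofReal_mul (by positivity), ← Real.exp_add]
  congr 2
  ring

/-- The exponential tilt moves all means onto the null law, so powers at any alternative can be
compared by pointwise inequalities. -/
theorem power_gaussPair (θ : ℝ × ℝ) (φ : ℝ × ℝ → ℝ) :
    power (gaussPair θ) φ = Real.exp (-(θ.1 ^ 2 + θ.2 ^ 2) / 2) *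
      ∫ z, φ z * Real.exp (θ.1 * z.1 + θ.2 * z.2) ∂gaussPair 0 := by
  unfold power
  rw [gaussPair_eq_withDensity θ, integral_withDensity_eq_integral_toReal_smul (by fun_prop)
    (by simp), ← integral_const_mul]
  congr 1
  ext z
  rw [ENNReal.toReal_ofReal (by positivity), smul_eq_mul, mul_comm (φ z), ← mul_assoc,
    ← Real.exp_add]
  congr 2
  ring

/-- A convenient integrable envelope. -/
theorem integrable_exp_abs_add_abs (R : ℝ) :
    Integrable (fun z : ℝ × ℝ => Real.exp (R * (|z.1| + |z.2|))) (gaussPair 0) := by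
  have h1 : ∀ m : ℝ, Integrable (fun x : ℝ => Real.exp (R * |x|)) (gaussianReal m 1) := by
    intro m
    refine ((integrable_exp_mul_gaussianReal (μ := m) (v := 1) R).add
      (integrable_exp_mul_gaussianReal (μ := m) (v := 1) (-R))).mono' (by fun_prop)
      (Eventually.of_forall fun x => ?_)
    rw [Real.norm_of_nonneg (by positivity)]
    rcases abs_cases x with ⟨h, _⟩ | ⟨h, _⟩ <;> rw [h] <;> simp [Real.exp_nonneg]
  have := (h1 0).mul_prod (h1 0)
  refine this.congr (Eventually.of_forall fun z => ?_)
  simp only [← Real.exp_add, mul_add]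

/-- The coordinates of a functional on the plane. -/
theorem strongDual_prod_apply (L : StrongDual ℝ (ℝ × ℝ)) (z : ℝ × ℝ) :
    L z = L (1, 0) * z.1 + L (0, 1) * z.2 := by
  conv_lhs => rw [show z = z.1 • ((1 : ℝ), (0 : ℝ)) + z.2 • ((0 : ℝ), (1 : ℝ)) by
    ext <;> simp]
  rw [map_add, map_smul, map_smul, smul_eq_mul, smul_eq_mul, mul_comm, mul_comm z.2]

theorem charFunDual_gaussPair (θ : ℝ × ℝ) (L : StrongDual ℝ (ℝ × ℝ)) :
    charFunDual (gaussPair θ) L = Complex.exp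
      ((L (1, 0) * θ.1 + L (0, 1) * θ.2 : ℝ) * Complex.I
        - ((L (1, 0) ^ 2 + L (0, 1) ^ 2 : ℝ) : ℂ) / 2) := by
  unfold gaussPair
  have h1 : ∀ m : ℝ, ∀ M : StrongDual ℝ ℝ, charFunDual (gaussianReal m 1) M =
      charFun (gaussianReal m 1) (M 1) := by
    intro m M
    rw [charFunDual_apply, charFun_apply_real]
    congr 1
    ext x
    have : M x = x * M 1 := by
      conv_lhs => rw [show x = x • (1 : ℝ) by simp]
      rw [map_smul, smul_eq_mul]
    rw [this]
    push_cast
    ring_nf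
  rw [charFunDual_prod, h1, h1, charFun_gaussianReal, charFun_gaussianReal, ← Complex.exp_add]
  congr 1
  simp
  ring

/-- Orthogonal maps carry Gaussian pairs to Gaussian pairs. -/
theorem map_gaussPair (p q r s : ℝ) (h1 : p ^ 2 + q ^ 2 = 1) (h2 : r ^ 2 + s ^ 2 = 1)
    (h3 : p * r + q * s = 0) (θ : ℝ × ℝ) :
    (gaussPair θ).map (fun z => (p * z.1 + q * z.2, r * z.1 + s * z.2)) =
      gaussPair (p * θ.1 + q * θ.2, r * θ.1 + s * θ.2) := by
  let M : ℝ × ℝ →L[ℝ] ℝ × ℝ :=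
    (p • ContinuousLinearMap.fst ℝ ℝ ℝ + q • ContinuousLinearMap.snd ℝ ℝ ℝ).prod
      (r • ContinuousLinearMap.fst ℝ ℝ ℝ + s • ContinuousLinearMap.snd ℝ ℝ ℝ)
  have hM : (fun z : ℝ × ℝ => (p * z.1 + q * z.2, r * z.1 + s * z.2)) = M := by
    ext z <;> simp [M]
  rw [hM]
  have : IsProbabilityMeasure ((gaussPair θ).map M) :=
    Measure.isProbabilityMeasure_map (by fun_prop)
  apply Measure.ext_of_charFunDual
  ext L
  rw [charFunDual_map, charFunDual_gaussPair, charFunDual_gaussPair]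
  have e1 : (L ∘SL M) (1, 0) = L (1, 0) * p + L (0, 1) * r := by
    rw [ContinuousLinearMap.comp_apply, strongDual_prod_apply]; simp [M]
  have e2 : (L ∘SL M) (0, 1) = L (1, 0) * q + L (0, 1) * s := by
    rw [ContinuousLinearMap.comp_apply, strongDual_prod_apply]; simp [M]
  rw [e1, e2]
  congr 3
  · congr 1; ring
  · congr 1
    linear_combination L (1, 0) ^ 2 * h1 + L (0, 1) ^ 2 * h2 + 2 * L (1, 0) * L (0, 1) * h3

/-- Nonempty open sets have positive mass; this yields the strict inequalities for critical values
and separates tests with different rejection regions. -/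
instance isOpenPosMeasure_gaussPair (θ : ℝ × ℝ) : (gaussPair θ).IsOpenPosMeasure := by
  have h : ∀ m, (gaussianReal m 1).IsOpenPosMeasure := fun m =>
    (gaussianReal_absolutelyContinuous' m one_ne_zero).isOpenPosMeasure
  have := h θ.1
  have := h θ.2
  unfold gaussPair
  infer_instance

theorem one_sub_sq_pos {ρ : ℝ} (hρ : |ρ| < 1) : 0 < 1 - ρ ^ 2 := by
  have := (sq_lt_one_iff_abs_lt_one ρ).2 hρ
  linarith

/-- The orthogonalized pair has independent coordinates. -/
theorem map_orthogonalize_localLaw {ρ : ℝ} (hρ : |ρ| < 1) (θ : ℝ) :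
    (localLaw ρ θ).map (orthogonalize ρ) = gaussPair (0, (√(1 - ρ ^ 2))⁻¹ * θ) := by
  have hpos := one_sub_sq_pos hρ
  set s := √(1 - ρ ^ 2) with hs
  have hs0 : 0 < s := Real.sqrt_pos.2 hpos
  have hs2 : s ^ 2 = 1 - ρ ^ 2 := Real.sq_sqrt hpos.le
  -- The form is `(x₀ + ρ x₁)² + (1 - ρ²) x₁²`.
  have hS : (!![1, ρ; ρ, 1] : Matrix (Fin 2) (Fin 2) ℝ).PosSemidef := by
    refine Matrix.PosSemidef.of_dotProduct_mulVec_nonneg ?_ fun x => ?_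
    · ext i j; fin_cases i <;> fin_cases j <;> simp
    · simp [dotProduct, Fin.sum_univ_two, Matrix.mulVec]
      nlinarith [sq_nonneg (x 0 + ρ * x 1), mul_nonneg hpos.le (sq_nonneg (x 1))]
  let M : EuclideanSpace ℝ (Fin 2) →L[ℝ] ℝ × ℝ :=
    (EuclideanSpace.proj 0).prod
      (s⁻¹ • (EuclideanSpace.proj 1 - ρ • EuclideanSpace.proj 0))
  have hM : orthogonalize ρ ∘ (fun x : EuclideanSpace ℝ (Fin 2) => (x 0, x 1)) = M := by
    ext x <;> simp [M, orthogonalize, ← hs]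
  unfold localLaw
  rw [Measure.map_map (by unfold orthogonalize; fun_prop) (by fun_prop), hM]
  have : IsProbabilityMeasure
      ((multivariateGaussian !₂[(0 : ℝ), θ] !![1, ρ; ρ, 1]).map M) :=
    Measure.isProbabilityMeasure_map (by fun_prop)
  apply Measure.ext_of_charFunDual
  ext L
  rw [charFunDual_map, charFunDual_gaussPair, ← charFun_toDual_symm_eq_charFunDual,
    charFun_multivariateGaussian hS]
  -- `t` is the Riesz vector of `L ∘ M`, since the multivariate characteristic function is expressed
  -- by inner products.
  set t := (InnerProductSpace.toDual ℝ (EuclideanSpace ℝ (Fin 2))).symm (L ∘SL M) with ht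
  have key : ∀ x, inner ℝ t x = L (M x) := by
    intro x; rw [ht, InnerProductSpace.toDual_symm_apply]; rfl
  have t0 : t 0 = L (1, 0) - L (0, 1) * (s⁻¹ * ρ) := by
    have := key (EuclideanSpace.single 0 1)
    rw [strongDual_prod_apply] at this
    simp [M, EuclideanSpace.inner_single_right] at this
    rw [this]; ring
  have t1 : t 1 = L (0, 1) * s⁻¹ := by
    have := key (EuclideanSpace.single 1 1)
    rw [strongDual_prod_apply] at this
    simpa [M, EuclideanSpace.inner_single_right] using this
  congr 2
  · congr 2
    rw [key, strongDual_prod_apply]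
    simp [M]
  · congr 1
    norm_cast
    simp [dotProduct, Fin.sum_univ_two, Matrix.mulVec, t0, t1]
    field_simp
    linear_combination -L (0, 1) ^ 2 * hs2

/-! ### Quantiles -/

/-- Right continuity gives mass at least `1 - α` on `Iic c`, and approach from the left gives at
most `1 - α` on `Iio c`. Without atoms the two masses coincide, so the size is exact. -/
theorem measureReal_Ici_quantile (P : Measure ℝ) [IsProbabilityMeasure P] [NullSingletonClass P]
    {α : ℝ} (hα : 0 < α) (hα' : α < 1) : P.real (Set.Ici (quantile P (1 - α))) = α := by
  set S := {x : ℝ | 1 - α ≤ P.real (Set.Iic x)} with hS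
  set c := quantile P (1 - α) with hc
  have hcS : c = sInf S := rfl
  have hcdf : ∀ x, P.real (Set.Iic x) = cdf P x := fun x => (cdf_eq_real P x).symm
  have hne : S.Nonempty := by
    have := (tendsto_cdf_atTop P).eventually (lt_mem_nhds (by linarith : 1 - α < 1))
    obtain ⟨x, hx⟩ := this.exists
    exact ⟨x, by rw [hS, Set.mem_ofPred_eq, hcdf]; exact hx.le⟩
  have hbdd : BddBelow S := by
    have := (tendsto_cdf_atBot P).eventually (gt_mem_nhds (by linarith : (0 : ℝ) < 1 - α))
    obtain ⟨x, hx⟩ := this.exists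
    refine ⟨x, fun y hy => ?_⟩
    by_contra! hlt
    rw [hS, Set.mem_ofPred_eq, hcdf] at hy
    exact absurd (hy.trans (monotone_cdf P hlt.le)) (not_le.2 hx)
  have hge : 1 - α ≤ cdf P c := by
    have hr : Tendsto (cdf P) (𝓝[>] c) (𝓝 (cdf P c)) :=
      ((cdf P).right_continuous c).mono_left (nhdsWithin_mono _ Set.Ioi_subset_Ici_self)
    refine ge_of_tendsto hr ?_
    filter_upwards [self_mem_nhdsWithin] with x hx
    obtain ⟨y, hy, hyx⟩ := (csInf_lt_iff hbdd hne).1 (hcS ▸ hx : sInf S < x)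
    rw [hS, Set.mem_ofPred_eq, hcdf] at hy
    exact hy.trans (monotone_cdf P hyx.le)
  have hle : P.real (Set.Iio c) ≤ 1 - α := by
    have ht : Tendsto (fun n : ℕ => P (Set.Iic (c - 1 / ((n : ℝ) + 1)))) atTop
        (𝓝 (P (⋃ n : ℕ, Set.Iic (c - 1 / ((n : ℝ) + 1))))) := by
      apply tendsto_measure_iUnion_atTop
      intro m n hmn
      refine Set.Iic_subset_Iic.2 (sub_le_sub_left ?_ _)
      exact Nat.one_div_le_one_div hmn
    have hu : (⋃ n : ℕ, Set.Iic (c - 1 / ((n : ℝ) + 1))) = Set.Iio c := by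
      ext x
      simp only [Set.mem_iUnion, Set.mem_Iic, Set.mem_Iio]
      constructor
      · rintro ⟨n, hn⟩
        have : (0 : ℝ) < 1 / ((n : ℝ) + 1) := by positivity
        linarith
      · intro hx
        obtain ⟨n, hn⟩ := exists_nat_one_div_lt (sub_pos.2 hx)
        exact ⟨n, by linarith⟩
    rw [hu] at ht
    have ht' := (ENNReal.tendsto_toReal (measure_ne_top P (Set.Iio c))).comp ht
    refine le_of_tendsto ht' (Eventually.of_forall fun n => ?_)
    have hn : (0 : ℝ) < 1 / ((n : ℝ) + 1) := by positivity
    have : c - 1 / ((n : ℝ) + 1) ∉ S := fun h => by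
      have := csInf_le hbdd h
      rw [← hcS] at this
      linarith
    rw [hS, Set.mem_ofPred_eq, not_le] at this
    exact this.le
  have heq : P.real (Set.Iio c) = cdf P c := by
    rw [← hcdf]
    exact measureReal_congr Iio_ae_eq_Iic
  have : P.real (Set.Ici c) = 1 - P.real (Set.Iio c) := by
    rw [← Set.compl_Iio, probReal_compl_eq_one_sub measurableSet_Iio]
  linarith

/-- Positivity of `p` bounds the defining set below; for `p ≤ 0` the infimum would be the default
value `0`. -/
theorem quantile_le {P : Measure ℝ} [IsProbabilityMeasure P] {p x : ℝ} (hp : 0 < p)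
    (h : p ≤ P.real (Set.Iic x)) : quantile P p ≤ x := by
  refine csInf_le ?_ h
  have := (tendsto_cdf_atBot P).eventually (gt_mem_nhds hp)
  obtain ⟨y, hy⟩ := this.exists
  refine ⟨y, fun w hw => ?_⟩
  by_contra! hlt
  rw [Set.mem_ofPred_eq, ← cdf_eq_real] at hw
  exact absurd (hw.trans (monotone_cdf P hlt.le)) (not_le.2 hy)

/-! ### The fundamental lemma of Neyman and Pearson -/

/-- Up to null sets, `D` is nonnegative where `g` is positive and nonpositive where `g` is
negative; the integral of `D * g` is then positive unless `D` vanishes almost everywhere. -/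
theorem ae_eq_zero_of_integral_mul_nonpos {Ω : Type*} [MeasurableSpace Ω] {μ : Measure Ω}
    {D g : Ω → ℝ} (hDg : ∀ z, 0 ≤ D z * g z) (hint : Integrable (fun z => D z * g z) μ)
    (hg : ∀ᵐ z ∂μ, g z ≠ 0) (h : ∫ z, D z * g z ∂μ ≤ 0) : ∀ᵐ z ∂μ, D z = 0 := by
  have h0 : ∫ z, D z * g z ∂μ = 0 := le_antisymm h (integral_nonneg hDg)
  have := (integral_eq_zero_iff_of_nonneg_ae (Eventually.of_forall hDg) hint).1 h0
  filter_upwards [this, hg] with z hz hgz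
  exact (mul_eq_zero.1 hz).resolve_right hgz

theorem integrable_of_le_exp {g : ℝ × ℝ → ℝ} (hg : Measurable g) (C R : ℝ)
    (h : ∀ z, |g z| ≤ C * Real.exp (R * (|z.1| + |z.2|))) : Integrable g (gaussPair 0) :=
  ((integrable_exp_abs_add_abs R).const_mul C).mono' hg.aestronglyMeasurable
    (Eventually.of_forall h)

theorem linear_le_mul_abs_add_abs {u v r : ℝ} (hu : |u| ≤ r) (hv : |v| ≤ r) (z : ℝ × ℝ) :
    |u * z.1 + v * z.2| ≤ r * (|z.1| + |z.2|) := by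
  calc |u * z.1 + v * z.2| ≤ |u * z.1| + |v * z.2| := abs_add_le _ _
    _ = |u| * |z.1| + |v| * |z.2| := by rw [abs_mul, abs_mul]
    _ ≤ r * |z.1| + r * |z.2| := by gcongr
    _ = r * (|z.1| + |z.2|) := by ring

theorem integrable_mul_exp {D : ℝ × ℝ → ℝ} (hD : Measurable D) (hD1 : ∀ z, |D z| ≤ 1) (u v : ℝ) :
    Integrable (fun z => D z * Real.exp (u * z.1 + v * z.2)) (gaussPair 0) := by
  refine integrable_of_le_exp (by fun_prop) 1 (max |u| |v|) fun z => ?_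
  rw [abs_mul, abs_of_nonneg (Real.exp_nonneg _)]
  exact mul_le_mul (hD1 z) (Real.exp_le_exp.2 ((le_abs_self _).trans
    (linear_le_mul_abs_add_abs (le_max_left _ _) (le_max_right _ _) z))) (Real.exp_nonneg _)
    zero_le_one

theorem integrable_of_abs_le_one {D : ℝ × ℝ → ℝ} (hD : Measurable D) (hD1 : ∀ z, |D z| ≤ 1) :
    Integrable D (gaussPair 0) := by
  simpa using integrable_mul_exp hD hD1 0 0

theorem IsTest.abs_le_one {φ : ℝ × ℝ → ℝ} (h : IsTest φ) (z : ℝ × ℝ) : |φ z| ≤ 1 :=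
  abs_le.2 ⟨by linarith [(h.2 z).1], (h.2 z).2⟩

theorem IsTest.abs_sub_le_one {φ ψ : ℝ × ℝ → ℝ} (hφ : IsTest φ) (hψ : IsTest ψ) (z : ℝ × ℝ) :
    |φ z - ψ z| ≤ 1 :=
  abs_le.2 ⟨by linarith [(hφ.2 z).1, (hψ.2 z).2], by linarith [(hφ.2 z).2, (hψ.2 z).1]⟩

theorem power_sub_power {φ ψ : ℝ × ℝ → ℝ} (hφ : IsTest φ) (hψ : IsTest ψ) (θ : ℝ × ℝ) :
    power (gaussPair θ) φ - power (gaussPair θ) ψ = Real.exp (-(θ.1 ^ 2 + θ.2 ^ 2) / 2) *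
      ∫ z, (φ z - ψ z) * Real.exp (θ.1 * z.1 + θ.2 * z.2) ∂gaussPair 0 := by
  rw [power_gaussPair, power_gaussPair, ← mul_sub, ← integral_sub
    (integrable_mul_exp hφ.1 hφ.abs_le_one _ _) (integrable_mul_exp hψ.1 hψ.abs_le_one _ _)]
  simp only [sub_mul]

theorem power_eq_of_ae_eq {φ ψ : ℝ × ℝ → ℝ} (h : ∀ᵐ z ∂gaussPair 0, φ z - ψ z = 0)
    (θ : ℝ × ℝ) : power (gaussPair θ) φ = power (gaussPair θ) ψ := by
  rw [power_gaussPair, power_gaussPair]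
  congr 1
  refine integral_congr_ae ?_
  filter_upwards [h] with z hz
  rw [sub_eq_zero.1 hz]

/-- Dominated convergence on a unit ball of means. It transfers power inequalities from a dense set
of alternatives to all means. -/
theorem continuous_power {φ : ℝ × ℝ → ℝ} (hφ : IsTest φ) :
    Continuous fun θ => power (gaussPair θ) φ := by
  simp only [power_gaussPair]
  refine Continuous.mul (by fun_prop) (continuous_iff_continuousAt.2 fun θ₀ => ?_)
  refine continuousAt_of_dominated
    (bound := fun z => 1 * Real.exp ((‖θ₀‖ + 1) * (|z.1| + |z.2|))) ?_ ?_
    ((integrable_exp_abs_add_abs _).const_mul 1) ?_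
  · exact Eventually.of_forall fun θ => (integrable_mul_exp hφ.1 hφ.abs_le_one _ _).1
  · filter_upwards [Metric.ball_mem_nhds θ₀ one_pos] with θ hθ
    refine Eventually.of_forall fun z => ?_
    have hn : ‖θ‖ ≤ ‖θ₀‖ + 1 := by
      have := norm_sub_norm_le θ θ₀
      rw [Metric.mem_ball, dist_eq_norm] at hθ
      linarith
    rw [Real.norm_eq_abs, abs_mul, abs_of_nonneg (Real.exp_nonneg _)]
    refine mul_le_mul (hφ.abs_le_one z) (Real.exp_le_exp.2 ((le_abs_self _).trans
      (linear_le_mul_abs_add_abs ?_ ?_ z))) (Real.exp_nonneg _) zero_le_one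
    · exact (norm_fst_le θ).trans hn
    · exact (norm_snd_le θ).trans hn
  · exact Eventually.of_forall fun z => by fun_prop

/-! ### The combined statistic -/

theorem continuous_combStat (a : ℝ × ℝ) (ρ : ℝ) : Continuous (combStat a ρ) := by
  unfold combStat; fun_prop

theorem measurable_combStat (a : ℝ × ℝ) (ρ : ℝ) : Measurable (combStat a ρ) :=
  (continuous_combStat a ρ).measurable

theorem combStat_nonneg {abar : ℝ} (habar : abar < 1) {a : ℝ × ℝ} (ha : a ∈ weightSet abar)
    (ρ : ℝ) (z : ℝ × ℝ) : 0 ≤ combStat a ρ z := by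
  obtain ⟨⟨h1, -⟩, ⟨h2, -⟩, h3⟩ := ha
  have : 0 ≤ 1 - a.1 - a.2 := by linarith
  unfold combStat
  positivity

theorem combStat_eq {ρ : ℝ} (hρ : |ρ| ≤ 1) (a z : ℝ × ℝ) :
    combStat a ρ z = (a.1 + a.2 * ρ ^ 2) * z.1 ^ 2 + 2 * (a.2 * ρ * √(1 - ρ ^ 2)) * z.1 * z.2
      + (1 - a.1 - a.2 * ρ ^ 2) * z.2 ^ 2 := by
  have h : √(1 - ρ ^ 2) ^ 2 = 1 - ρ ^ 2 :=
    Real.sq_sqrt (by linarith [(sq_le_one_iff_abs_le_one ρ).2 hρ])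
  unfold combStat
  linear_combination a.2 * z.2 ^ 2 * h

/-- The statistic is a convex combination of three squared projections of `z` on unit vectors, each
at most `‖z‖²` in the Euclidean sense. -/
theorem combStat_le {abar : ℝ} (habar : abar < 1) {a : ℝ × ℝ} (ha : a ∈ weightSet abar)
    {ρ : ℝ} (hρ : |ρ| ≤ 1) (z : ℝ × ℝ) : combStat a ρ z ≤ z.1 ^ 2 + z.2 ^ 2 := by
  obtain ⟨⟨h1, -⟩, ⟨h2, -⟩, h3⟩ := ha
  have hs : √(1 - ρ ^ 2) ^ 2 = 1 - ρ ^ 2 :=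
    Real.sq_sqrt (by linarith [(sq_le_one_iff_abs_le_one ρ).2 hρ])
  have h : (ρ * z.1 + √(1 - ρ ^ 2) * z.2) ^ 2 ≤ z.1 ^ 2 + z.2 ^ 2 := by
    nlinarith [sq_nonneg (√(1 - ρ ^ 2) * z.1 - ρ * z.2)]
  unfold combStat
  nlinarith [mul_le_mul_of_nonneg_left h h2, sq_nonneg z.1, sq_nonneg z.2,
    mul_nonneg (by linarith : (0 : ℝ) ≤ 1 - a.1 - a.2) (sq_nonneg z.1),
    mul_nonneg h1 (sq_nonneg z.2)]

/-- For a fixed first coordinate the level set consists of roots of a quadratic in the second. Its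
leading coefficient is nonzero because `a₁ + a₂ ≤ abar < 1`, so each slice is finite and hence null.
-/
theorem ae_combStat_ne {abar : ℝ} (habar : abar < 1) {a : ℝ × ℝ} (ha : a ∈ weightSet abar)
    {ρ : ℝ} (hρ : |ρ| ≤ 1) (t : ℝ) : ∀ᵐ z ∂gaussPair 0, combStat a ρ z ≠ t := by
  have := nullSingletonClass_gaussianReal (μ := 0) (v := 1) one_ne_zero
  have hlead : 1 - a.1 - a.2 * ρ ^ 2 ≠ 0 := by
    obtain ⟨⟨h1, -⟩, ⟨h2, -⟩, h3⟩ := ha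
    have := (sq_le_one_iff_abs_le_one ρ).2 hρ
    nlinarith [mul_le_mul_of_nonneg_left this h2]
  have hms : MeasurableSet {z | combStat a ρ z = t} :=
    measurableSet_eq_fun (measurable_combStat a ρ) measurable_const
  rw [ae_iff]
  simp only [ne_eq, not_not]
  refine (Measure.measure_prod_null hms).2 (Eventually.of_forall fun x => ?_)
  refine Set.Finite.measure_zero ?_ _
  let p : Polynomial ℝ := Polynomial.C (1 - a.1 - a.2 * ρ ^ 2) * Polynomial.X ^ 2
    + Polynomial.C (2 * (a.2 * ρ * √(1 - ρ ^ 2)) * x) * Polynomial.X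
    + Polynomial.C ((a.1 + a.2 * ρ ^ 2) * x ^ 2 - t)
  have hp : p ≠ 0 := fun h => hlead <| by
    have := Polynomial.leadingCoeff_quadratic (b := 2 * (a.2 * ρ * √(1 - ρ ^ 2)) * x)
      (c := (a.1 + a.2 * ρ ^ 2) * x ^ 2 - t) hlead
    rw [← this]
    exact Polynomial.leadingCoeff_eq_zero.2 h
  refine (Polynomial.finite_setOfPred_isRoot hp).subset fun y hy => ?_
  have hy' : combStat a ρ (x, y) = t := hy
  rw [combStat_eq hρ] at hy'
  simp only [Set.mem_ofPred_eq, Polynomial.IsRoot, p, Polynomial.eval_add, Polynomial.eval_mul,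
    Polynomial.eval_C, Polynomial.eval_pow, Polynomial.eval_X]
  simp only at hy'
  linarith

theorem isTest_combTest (α : ℝ) (a : ℝ × ℝ) (ρ : ℝ) : IsTest (combTest α a ρ) := by
  refine ⟨measurable_one.indicator (measurableSet_le measurable_const (measurable_combStat a ρ)),
    fun z => ?_⟩
  unfold combTest
  by_cases h : z ∈ {z | critVal α a ρ ≤ combStat a ρ z} <;> simp [h]

theorem power_combTest {α : ℝ} (hα : 0 < α) (hα' : α < 1) {abar : ℝ} (habar : abar < 1)
    {a : ℝ × ℝ} (ha : a ∈ weightSet abar) {ρ : ℝ} (hρ : |ρ| ≤ 1) :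
    power (gaussPair 0) (combTest α a ρ) = α := by
  have hm := measurable_combStat a ρ
  have : IsProbabilityMeasure ((gaussPair 0).map (combStat a ρ)) :=
    Measure.isProbabilityMeasure_map hm.aemeasurable
  have : NullSingletonClass ((gaussPair 0).map (combStat a ρ)) := ⟨fun t => by
    rw [Measure.map_apply hm (measurableSet_singleton t)]
    have := ae_combStat_ne habar ha hρ t
    rw [ae_iff] at this
    simp only [ne_eq, not_not] at this
    exact this⟩
  have h := measureReal_Ici_quantile ((gaussPair 0).map (combStat a ρ)) hα hα'
  rw [map_measureReal_apply hm measurableSet_Ici] at h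
  unfold power combTest
  rw [integral_indicator_one (measurableSet_le measurable_const hm)]
  exact h

/-- Otherwise the test would always reject, the statistic being nonnegative, and its size would be
`1`. -/
theorem critVal_pos {α : ℝ} (hα : 0 < α) (hα' : α < 1) {abar : ℝ} (habar : abar < 1)
    {a : ℝ × ℝ} (ha : a ∈ weightSet abar) {ρ : ℝ} (hρ : |ρ| ≤ 1) : 0 < critVal α a ρ := by
  by_contra! hle
  have h := power_combTest hα hα' habar ha hρ
  have h1 : combTest α a ρ = fun _ => 1 := by
    ext z
    unfold combTest
    rw [Set.indicator_of_mem]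
    · rfl
    · exact hle.trans (combStat_nonneg habar ha ρ z)
  rw [h1] at h
  simp [power] at h
  linarith

/-- The difference between the combined test and another test has the sign of the difference
between the statistic and its critical value. -/
theorem combTest_sub_mul_nonneg {ψ : ℝ × ℝ → ℝ} (hψ : IsTest ψ) (α : ℝ) (a : ℝ × ℝ) (ρ : ℝ)
    {g : ℝ × ℝ → ℝ} (hpos : ∀ z, critVal α a ρ ≤ combStat a ρ z → 0 ≤ g z)
    (hneg : ∀ z, combStat a ρ z < critVal α a ρ → g z ≤ 0) (z : ℝ × ℝ) :
    0 ≤ (combTest α a ρ z - ψ z) * g z := by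
  unfold combTest
  by_cases h : critVal α a ρ ≤ combStat a ρ z
  · rw [Set.indicator_of_mem (by exact h)]
    exact mul_nonneg (sub_nonneg.2 (hψ.2 z).2) (hpos z h)
  · rw [Set.indicator_of_notMem (by exact h), zero_sub]
    exact mul_nonneg_of_nonpos_of_nonpos (neg_nonpos.2 (hψ.2 z).1) (hneg z (not_le.1 h))

/-! ### Rotation to the principal axes -/

theorem rotate_zero (U : Matrix (Fin 2) (Fin 2) ℝ) (z : ℝ × ℝ) :
    rotate U z 0 = U 0 0 * z.1 + U 1 0 * z.2 := by
  simp [rotate, Matrix.mulVec, dotProduct, Fin.sum_univ_two]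

theorem rotate_one (U : Matrix (Fin 2) (Fin 2) ℝ) (z : ℝ × ℝ) :
    rotate U z 1 = U 0 1 * z.1 + U 1 1 * z.2 := by
  simp [rotate, Matrix.mulVec, dotProduct, Fin.sum_univ_two]

/-- The rotated pair, as a pair. -/
def rotatePair (U : Matrix (Fin 2) (Fin 2) ℝ) (z : ℝ × ℝ) : ℝ × ℝ :=
  (U 0 0 * z.1 + U 1 0 * z.2, U 0 1 * z.1 + U 1 1 * z.2)

theorem orthogonal_columns {U : Matrix (Fin 2) (Fin 2) ℝ} (hU : U ∈ orthogonalGroup (Fin 2) ℝ) :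
    U 0 0 ^ 2 + U 1 0 ^ 2 = 1 ∧ U 0 1 ^ 2 + U 1 1 ^ 2 = 1 ∧
      U 0 0 * U 0 1 + U 1 0 * U 1 1 = 0 := by
  have h := (mem_orthogonalGroup_iff' (Fin 2) ℝ).1 hU
  have h00 := congrFun (congrFun h 0) 0
  have h11 := congrFun (congrFun h 1) 1
  have h01 := congrFun (congrFun h 0) 1
  simp [Matrix.mul_apply, Fin.sum_univ_two] at h00 h11 h01
  exact ⟨by linarith, by linarith, h01⟩

theorem orthogonal_rows {U : Matrix (Fin 2) (Fin 2) ℝ} (hU : U ∈ orthogonalGroup (Fin 2) ℝ) :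
    U 0 0 ^ 2 + U 0 1 ^ 2 = 1 ∧ U 1 0 ^ 2 + U 1 1 ^ 2 = 1 ∧
      U 0 0 * U 1 0 + U 0 1 * U 1 1 = 0 := by
  have h := (mem_orthogonalGroup_iff (Fin 2) ℝ).1 hU
  have h00 := congrFun (congrFun h 0) 0
  have h11 := congrFun (congrFun h 1) 1
  have h01 := congrFun (congrFun h 0) 1
  simp [Matrix.mul_apply, Fin.sum_univ_two] at h00 h11 h01
  exact ⟨by linarith, by linarith, h01⟩

theorem power_comp_rotatePair {U : Matrix (Fin 2) (Fin 2) ℝ}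
    (hU : U ∈ orthogonalGroup (Fin 2) ℝ) {g : ℝ × ℝ → ℝ} (hg : Measurable g) (θ : ℝ × ℝ) :
    power (gaussPair θ) (fun z => g (rotatePair U z)) = power (gaussPair (rotatePair U θ)) g := by
  obtain ⟨h1, h2, h3⟩ := orthogonal_columns hU
  have h := map_gaussPair (U 0 0) (U 1 0) (U 0 1) (U 1 1) h1 h2 h3 θ
  unfold power
  rw [show gaussPair (rotatePair U θ) = _ from h.symm,
    integral_map (by fun_prop) hg.aestronglyMeasurable]
  rfl

theorem IsEigenDecomp.combStat_eq {a : ℝ × ℝ} {ρ : ℝ} {U : Matrix (Fin 2) (Fin 2) ℝ}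
    {ν : Fin 2 → ℝ} (h : IsEigenDecomp a ρ U ν) (hρ : |ρ| ≤ 1) (z : ℝ × ℝ) :
    combStat a ρ z = ν 0 * (rotatePair U z).1 ^ 2 + ν 1 * (rotatePair U z).2 ^ 2 := by
  rw [JackknifeCLC.combStat_eq hρ]
  have h00 := congrFun (congrFun h.eq 0) 0
  have h01 := congrFun (congrFun h.eq 0) 1
  have h11 := congrFun (congrFun h.eq 1) 1
  simp [weightMatrix, Matrix.mul_apply, Fin.sum_univ_two] at h00 h01 h11
  simp only [rotatePair]
  linear_combination z.1 ^ 2 * h00 + 2 * z.1 * z.2 * h01 + z.2 ^ 2 * h11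

/-- The form evaluated at the second eigenvector is `ν 1`, hence nonnegative, and the matrix of
weights has trace one. -/
theorem IsEigenDecomp.eigenvalues {abar : ℝ} (habar : abar < 1) {a : ℝ × ℝ}
    (ha : a ∈ weightSet abar) {ρ : ℝ} {U : Matrix (Fin 2) (Fin 2) ℝ} {ν : Fin 2 → ℝ}
    (h : IsEigenDecomp a ρ U ν) (hρ : |ρ| ≤ 1) : 0 ≤ ν 0 ∧ 0 ≤ ν 1 ∧ ν 0 + ν 1 = 1 := by
  obtain ⟨c1, c2, c3⟩ := orthogonal_columns h.orthogonal
  obtain ⟨r1, r2, r3⟩ := orthogonal_rows h.orthogonal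
  have h1 : 0 ≤ ν 1 := by
    have e := h.combStat_eq hρ (U 0 1, U 1 1)
    have e' := combStat_nonneg habar ha ρ (U 0 1, U 1 1)
    rw [e] at e'
    simp only [rotatePair] at e'
    rw [c3, show U 0 1 * U 0 1 + U 1 1 * U 1 1 = 1 by linarith] at e'
    linarith
  have htr : ν 0 + ν 1 = 1 := by
    have h00 := congrFun (congrFun h.eq 0) 0
    have h11 := congrFun (congrFun h.eq 1) 1
    simp [weightMatrix, Matrix.mul_apply, Fin.sum_univ_two] at h00 h11
    linear_combination (-h00) - h11 - ν 0 * c1 - ν 1 * c2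
  exact ⟨h1.trans h.ordered, h1, htr⟩

/-! ### Weak identification: local expansion of the power and admissibility -/

theorem abs_exp_sub_taylor_le (w : ℝ) :
    |Real.exp w - (1 + w + w ^ 2 / 2 + w ^ 3 / 6)| ≤ |w| ^ 4 * Real.exp |w| := by
  have h := Complex.norm_exp_sub_sum_le_norm_mul_exp (w : ℂ) 4
  have e : Complex.exp w - ∑ m ∈ Finset.range 4, (w : ℂ) ^ m / (m.factorial : ℂ)
      = ((Real.exp w - (1 + w + w ^ 2 / 2 + w ^ 3 / 6) : ℝ) : ℂ) := by
    simp [Finset.sum_range_succ, Nat.factorial]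
  rw [e, Complex.norm_real, Complex.norm_real] at h
  exact h

/-- The average over the signs of the coordinates of `exp (u x + v y)` agrees to fourth order with
`1 + (u² x² + v² y²) / 2`. -/
theorem abs_sign_average_exp_sub_le {r u v : ℝ} (hr : r ≤ 1) (hu : |u| ≤ r) (hv : |v| ≤ r)
    (z : ℝ × ℝ) :
    |(Real.exp (u * z.1 + v * z.2) + Real.exp (-u * z.1 + v * z.2) + Real.exp (u * z.1 + -v * z.2)
        + Real.exp (-u * z.1 + -v * z.2)) / 4 - (1 + (u ^ 2 * z.1 ^ 2 + v ^ 2 * z.2 ^ 2) / 2)| ≤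
      r ^ 4 * (24 * Real.exp (2 * (|z.1| + |z.2|))) := by
  have hr0 : 0 ≤ r := (abs_nonneg u).trans hu
  set m := |z.1| + |z.2| with hm
  have hm0 : 0 ≤ m := by positivity
  have key : ∀ w : ℝ, |w| ≤ r * m →
      |Real.exp w - (1 + w + w ^ 2 / 2 + w ^ 3 / 6)| ≤ r ^ 4 * (24 * Real.exp (2 * m)) := by
    intro w hw
    refine (abs_exp_sub_taylor_le w).trans ?_
    have h1 : |w| ^ 4 ≤ r ^ 4 * m ^ 4 := by
      rw [← mul_pow]; gcongr
    have h2 : Real.exp |w| ≤ Real.exp m :=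
      Real.exp_le_exp.2 (hw.trans (mul_le_of_le_one_left hm0 hr))
    -- The constant is `4!`, from one term of the exponential series.
    have h3 : m ^ 4 ≤ 24 * Real.exp m := by
      have := Real.pow_div_factorial_le_exp m hm0 4
      rw [div_le_iff₀ (by positivity)] at this
      norm_num [Nat.factorial] at this
      linarith
    calc |w| ^ 4 * Real.exp |w| ≤ r ^ 4 * m ^ 4 * Real.exp m := by gcongr
      _ ≤ r ^ 4 * (24 * Real.exp m) * Real.exp m := by gcongr
      _ = r ^ 4 * (24 * Real.exp (2 * m)) := by rw [show 2 * m = m + m by ring, Real.exp_add m m]; ring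
  have hu' : |-u| ≤ r := by rwa [abs_neg]
  have hv' : |-v| ≤ r := by rwa [abs_neg]
  have k1 := abs_le.1 (key _ (linear_le_mul_abs_add_abs hu hv z))
  have k2 := abs_le.1 (key _ (linear_le_mul_abs_add_abs hu' hv z))
  have k3 := abs_le.1 (key _ (linear_le_mul_abs_add_abs hu hv' z))
  have k4 := abs_le.1 (key _ (linear_le_mul_abs_add_abs hu' hv' z))
  -- Averaging the four cubic Taylor polynomials cancels the linear and cubic terms and the cross
  -- term `u v x y`.
  rw [abs_le]
  constructor <;> nlinarith [k1.1, k1.2, k2.1, k2.2, k3.1, k3.2, k4.1, k4.2]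

theorem integral_comp_neg_fst {g : ℝ × ℝ → ℝ} (hg : Measurable g) :
    ∫ z, g (-z.1, z.2) ∂gaussPair 0 = ∫ z, g z ∂gaussPair 0 := by
  have h := map_gaussPair (-1) 0 0 1 (by norm_num) (by norm_num) (by norm_num) 0
  simp only [Prod.fst_zero, Prod.snd_zero, mul_zero, add_zero] at h
  conv_rhs => rw [show gaussPair 0 = _ from h.symm]
  rw [integral_map (by fun_prop) hg.aestronglyMeasurable]
  simp

theorem integral_comp_neg_snd {g : ℝ × ℝ → ℝ} (hg : Measurable g) :
    ∫ z, g (z.1, -z.2) ∂gaussPair 0 = ∫ z, g z ∂gaussPair 0 := by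
  have h := map_gaussPair 1 0 0 (-1) (by norm_num) (by norm_num) (by norm_num) 0
  simp only [Prod.fst_zero, Prod.snd_zero, mul_zero, add_zero] at h
  conv_rhs => rw [show gaussPair 0 = _ from h.symm]
  rw [integral_map (by fun_prop) hg.aestronglyMeasurable]
  simp

/-- Second-order expansion of the exponential integral of a function that is even in each
coordinate. -/
theorem exists_expansion_of_even {D : ℝ × ℝ → ℝ} (hD : Measurable D) (hD1 : ∀ z, |D z| ≤ 1)
    (he1 : ∀ z, D (-z.1, z.2) = D z) (he2 : ∀ z, D (z.1, -z.2) = D z) :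
    ∃ C : ℝ, 0 ≤ C ∧ ∀ r u v : ℝ, r ≤ 1 → |u| ≤ r → |v| ≤ r →
      |∫ z, D z * Real.exp (u * z.1 + v * z.2) ∂gaussPair 0
        - ∫ z, D z * (1 + (u ^ 2 * z.1 ^ 2 + v ^ 2 * z.2 ^ 2) / 2) ∂gaussPair 0| ≤ r ^ 4 * C := by
  have hint := (integrable_exp_abs_add_abs 2).const_mul 24
  refine ⟨∫ z, 24 * Real.exp (2 * (|z.1| + |z.2|)) ∂gaussPair 0,
    integral_nonneg fun z => by positivity, fun r u v hr hu hv => ?_⟩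
  have i1 := integrable_mul_exp hD hD1 u v
  have i2 := integrable_mul_exp hD hD1 (-u) v
  have i3 := integrable_mul_exp hD hD1 u (-v)
  have i4 := integrable_mul_exp hD hD1 (-u) (-v)
  have e1 : ∀ s t : ℝ, ∫ z, D z * Real.exp (-s * z.1 + t * z.2) ∂gaussPair 0
      = ∫ z, D z * Real.exp (s * z.1 + t * z.2) ∂gaussPair 0 := by
    intro s t
    rw [← integral_comp_neg_fst (g := fun z => D z * Real.exp (s * z.1 + t * z.2)) (by fun_prop)]
    simp only [he1, mul_neg, neg_mul]
  have e2 : ∀ s t : ℝ, ∫ z, D z * Real.exp (s * z.1 + -t * z.2) ∂gaussPair 0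
      = ∫ z, D z * Real.exp (s * z.1 + t * z.2) ∂gaussPair 0 := by
    intro s t
    rw [← integral_comp_neg_snd (g := fun z => D z * Real.exp (s * z.1 + t * z.2)) (by fun_prop)]
    simp only [he2, mul_neg, neg_mul]
  -- Since `D` and the law are even in each coordinate, the exponential may be replaced by its sign
  -- average.
  set A : ℝ × ℝ → ℝ := fun z => (Real.exp (u * z.1 + v * z.2) + Real.exp (-u * z.1 + v * z.2)
    + Real.exp (u * z.1 + -v * z.2) + Real.exp (-u * z.1 + -v * z.2)) / 4 with hA
  have hAeq : (fun z => D z * A z) = fun z => (1 / 4 : ℝ) * (D z * Real.exp (u * z.1 + v * z.2)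
      + D z * Real.exp (-u * z.1 + v * z.2) + D z * Real.exp (u * z.1 + -v * z.2)
      + D z * Real.exp (-u * z.1 + -v * z.2)) := by
    ext z; simp only [hA]; ring
  have hAint : Integrable (fun z => D z * A z) (gaussPair 0) := by
    rw [hAeq]
    exact (((i1.add i2).add i3).add i4).const_mul _
  have hsym : ∫ z, D z * Real.exp (u * z.1 + v * z.2) ∂gaussPair 0
      = ∫ z, D z * A z ∂gaussPair 0 := by
    have j2 : Integrable (fun z => D z * Real.exp (u * z.1 + v * z.2)
        + D z * Real.exp (-u * z.1 + v * z.2)) (gaussPair 0) := i1.add i2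
    have j3 : Integrable (fun z => D z * Real.exp (u * z.1 + v * z.2)
        + D z * Real.exp (-u * z.1 + v * z.2) + D z * Real.exp (u * z.1 + -v * z.2))
        (gaussPair 0) := j2.add i3
    rw [hAeq, integral_const_mul, integral_add j3 i4, integral_add j2 i3, integral_add i1 i2,
      e1 u (-v), e2, e1]
    ring
  have hpt : ∀ z, ‖D z * A z - D z * (1 + (u ^ 2 * z.1 ^ 2 + v ^ 2 * z.2 ^ 2) / 2)‖ ≤
      r ^ 4 * (24 * Real.exp (2 * (|z.1| + |z.2|))) := by
    intro z
    rw [← mul_sub, norm_mul, Real.norm_eq_abs, Real.norm_eq_abs]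
    calc _ ≤ 1 * |A z - (1 + (u ^ 2 * z.1 ^ 2 + v ^ 2 * z.2 ^ 2) / 2)| := by
          gcongr; exact hD1 z
      _ ≤ _ := by rw [one_mul]; exact abs_sign_average_exp_sub_le hr hu hv z
  have hsub : Integrable
      (fun z => D z * A z - D z * (1 + (u ^ 2 * z.1 ^ 2 + v ^ 2 * z.2 ^ 2) / 2))
      (gaussPair 0) :=
    (hint.const_mul (r ^ 4)).mono' (by fun_prop) (Eventually.of_forall hpt)
  have hP : Integrable (fun z => D z * (1 + (u ^ 2 * z.1 ^ 2 + v ^ 2 * z.2 ^ 2) / 2))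
      (gaussPair 0) := by
    refine (hAint.sub hsub).congr (Eventually.of_forall fun z => ?_)
    simp
  rw [hsym, ← integral_sub hAint hP, ← integral_const_mul]
  exact norm_integral_le_of_norm_le (hint.const_mul _) (Eventually.of_forall hpt)

theorem integrable_mul_quadratic {D : ℝ × ℝ → ℝ} (hD : Measurable D) (hD1 : ∀ z, |D z| ≤ 1)
    (p q : ℝ) :
    Integrable (fun z => D z * (p * z.1 ^ 2 + q * z.2 ^ 2)) (gaussPair 0) := by
  refine integrable_of_le_exp (by fun_prop) (2 * (|p| + |q|)) 1 fun z => ?_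
  rw [abs_mul, one_mul]
  set m := |z.1| + |z.2| with hm
  have hm0 : 0 ≤ m := by positivity
  have h3 : m ^ 2 ≤ 2 * Real.exp m := by
    have := Real.pow_div_factorial_le_exp m hm0 2
    rw [div_le_iff₀ (by positivity)] at this
    norm_num [Nat.factorial] at this
    linarith
  have hx : z.1 ^ 2 ≤ m ^ 2 := by
    rw [← sq_abs z.1]; gcongr; rw [hm]; linarith [abs_nonneg z.2]
  have hy : z.2 ^ 2 ≤ m ^ 2 := by
    rw [← sq_abs z.2]; gcongr; rw [hm]; linarith [abs_nonneg z.1]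
  have h4 : |p * z.1 ^ 2 + q * z.2 ^ 2| ≤ (|p| + |q|) * m ^ 2 := by
    calc _ ≤ |p * z.1 ^ 2| + |q * z.2 ^ 2| := abs_add_le _ _
      _ = |p| * z.1 ^ 2 + |q| * z.2 ^ 2 := by
        rw [abs_mul, abs_mul, abs_of_nonneg (sq_nonneg z.1), abs_of_nonneg (sq_nonneg z.2)]
      _ ≤ |p| * m ^ 2 + |q| * m ^ 2 := by gcongr
      _ = _ := by ring
  calc _ ≤ 1 * ((|p| + |q|) * m ^ 2) := mul_le_mul (hD1 z) h4 (abs_nonneg _) zero_le_one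
    _ ≤ 1 * ((|p| + |q|) * (2 * Real.exp m)) := by gcongr
    _ = _ := by ring

/-- If `D` has the sign of `p x² + q y² - c` and nonnegative integral, then it vanishes almost
everywhere or has positive exponential integrals along small multiples of `(√p, √q)`. -/
theorem ae_eq_zero_or_integral_exp_pos {D : ℝ × ℝ → ℝ} (hD : Measurable D)
    (hD1 : ∀ z, |D z| ≤ 1) (he1 : ∀ z, D (-z.1, z.2) = D z) (he2 : ∀ z, D (z.1, -z.2) = D z)
    {p q c : ℝ} (hp : 0 ≤ p) (hq : 0 ≤ q) (hpq : p + q = 1) (hc : 0 ≤ c)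
    (hsign : ∀ z, 0 ≤ D z * (p * z.1 ^ 2 + q * z.2 ^ 2 - c))
    (hne : ∀ᵐ z ∂gaussPair 0, p * z.1 ^ 2 + q * z.2 ^ 2 - c ≠ 0)
    (hD0 : 0 ≤ ∫ z, D z ∂gaussPair 0) :
    (∀ᵐ z ∂gaussPair 0, D z = 0) ∨ ∃ bbar : ℝ, 0 < bbar ∧ ∀ b : ℝ, 0 < b → b < bbar →
      ∀ θ : ℝ × ℝ, θ.1 ^ 2 = b * p → θ.2 ^ 2 = b * q →
        0 < ∫ z, D z * Real.exp (θ.1 * z.1 + θ.2 * z.2) ∂gaussPair 0 := by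
  have hi0 := integrable_of_abs_le_one hD hD1
  have hi1 := integrable_mul_quadratic hD hD1 p q
  have hi2 : Integrable (fun z => D z * (p * z.1 ^ 2 + q * z.2 ^ 2 - c)) (gaussPair 0) := by
    simp only [mul_sub]; exact hi1.sub (hi0.mul_const c)
  by_cases hle : ∫ z, D z * (p * z.1 ^ 2 + q * z.2 ^ 2 - c) ∂gaussPair 0 ≤ 0
  · exact Or.inl (ae_eq_zero_of_integral_mul_nonpos hsign hi2 hne hle)
  right
  push Not at hle
  set I := ∫ z, D z * (p * z.1 ^ 2 + q * z.2 ^ 2) ∂gaussPair 0 with hI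
  -- `I` is the positive integral of `D * (p x² + q y² - c)` plus `c ∫ D ≥ 0`.
  have hIpos : 0 < I := by
    simp only [mul_sub] at hle
    rw [integral_sub hi1 (hi0.mul_const c), integral_mul_const] at hle
    nlinarith [mul_nonneg hD0 hc]
  obtain ⟨C, hC, hexp⟩ := exists_expansion_of_even hD hD1 he1 he2
  -- The bound `1` keeps `√b` in the range of the expansion; the other makes the error `b² C`
  -- smaller than the gain `b I / 2`.
  refine ⟨min 1 (I / (2 * (C + 1))), lt_min one_pos (by positivity), fun b hb hbb θ h1 h2 => ?_⟩
  have hb1 : b < 1 := hbb.trans_le (min_le_left _ _)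
  have hb2 : b * (2 * (C + 1)) < I := by
    have := hbb.trans_le (min_le_right _ _)
    rwa [lt_div_iff₀ (by positivity)] at this
  have hr1 : √b ≤ 1 := Real.sqrt_le_one.2 hb1.le
  have hsq : ∀ x y : ℝ, 0 ≤ y → y ≤ 1 → x ^ 2 = b * y → |x| ≤ √b := by
    intro x y hy hy1 hx
    refine Real.abs_le_sqrt ?_
    rw [hx]; exact mul_le_of_le_one_right hb.le hy1
  have h := hexp √b θ.1 θ.2 hr1 (hsq _ p hp (by linarith) h1) (hsq _ q hq (by linarith) h2)
  have hr4 : √b ^ 4 = b ^ 2 := by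
    rw [show √b ^ 4 = (√b ^ 2) ^ 2 by ring, Real.sq_sqrt hb.le]
  have hmain : ∫ z, D z * (1 + (θ.1 ^ 2 * z.1 ^ 2 + θ.2 ^ 2 * z.2 ^ 2) / 2) ∂gaussPair 0
      = ∫ z, D z ∂gaussPair 0 + b / 2 * I := by
    rw [hI, ← integral_const_mul, ← integral_add hi0 (hi1.const_mul _)]
    congr 1
    ext z
    rw [h1, h2]; ring
  rw [hmain, hr4] at h
  have := (abs_le.1 h).1
  nlinarith [mul_pos hb (sub_pos.2 hb2), mul_pos hb hb]

/-- Members of `squareTests` have, in rotated coordinates, a test that is even in each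
coordinate. -/
theorem power_comp_squares {U : Matrix (Fin 2) (Fin 2) ℝ} (hU : U ∈ orthogonalGroup (Fin 2) ℝ)
    {f φ : ℝ × ℝ → ℝ} (hf : IsTest f)
    (hφ : ∀ z, φ z = f (rotate U z 0 ^ 2, rotate U z 1 ^ 2)) (θ : ℝ × ℝ) :
    power (gaussPair θ) φ =
      power (gaussPair (rotatePair U θ)) (fun w => f (w.1 ^ 2, w.2 ^ 2)) := by
  have hm : Measurable fun w : ℝ × ℝ => f (w.1 ^ 2, w.2 ^ 2) := hf.1.comp (by fun_prop)
  rw [← power_comp_rotatePair hU hm θ]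
  congr 1
  ext z
  rw [hφ, rotate_zero, rotate_one]
  rfl

theorem rotatePair_zero (U : Matrix (Fin 2) (Fin 2) ℝ) : rotatePair U 0 = 0 := by
  simp [rotatePair]

theorem rotatePair_surjective {U : Matrix (Fin 2) (Fin 2) ℝ}
    (hU : U ∈ orthogonalGroup (Fin 2) ℝ) (w : ℝ × ℝ) : ∃ θ, rotatePair U θ = w := by
  obtain ⟨h1, h2, h3⟩ := orthogonal_columns hU
  refine ⟨(U 0 0 * w.1 + U 0 1 * w.2, U 1 0 * w.1 + U 1 1 * w.2), ?_⟩
  unfold rotatePair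
  ext
  · simp only; linear_combination w.1 * h1 + w.2 * h3
  · simp only; linear_combination w.1 * h3 + w.2 * h2

/-! ### Local optimality and admissibility of the combined test -/

section WeakIdentification

variable {α abar : ℝ} {a : ℝ × ℝ} {ρ : ℝ} {U : Matrix (Fin 2) (Fin 2) ℝ} {ν : Fin 2 → ℝ}

theorem combTest_mem_squareTests (hα : 0 < α) (hα' : α < 1) (habar : abar < 1)
    (ha : a ∈ weightSet abar) (hρ : |ρ| ≤ 1) (h : IsEigenDecomp a ρ U ν) :
    combTest α a ρ ∈ squareTests U α := by
  refine ⟨⟨Set.indicator {w | critVal α a ρ ≤ ν 0 * w.1 + ν 1 * w.2} 1, ⟨?_, fun z => ?_⟩,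
    fun z => ?_⟩, (power_combTest hα hα' habar ha hρ).le⟩
  · exact measurable_one.indicator (measurableSet_le measurable_const (by fun_prop))
  · by_cases hz : z ∈ {w : ℝ × ℝ | critVal α a ρ ≤ ν 0 * w.1 + ν 1 * w.2} <;> simp [hz]
  · unfold combTest
    simp only [Set.indicator, Set.mem_ofPred_eq, h.combStat_eq hρ z, rotate_zero, rotate_one,
      rotatePair]
    rfl

/-- A competitor has the power of the combined test at every mean, or strictly less at all small
means in the direction of the square roots of the eigenvalues. -/
theorem power_eq_or_lt_combTest (hα : 0 < α) (hα' : α < 1) (habar : abar < 1)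
    (ha : a ∈ weightSet abar) (hρ : |ρ| ≤ 1) (h : IsEigenDecomp a ρ U ν) {φ : ℝ × ℝ → ℝ}
    (hφ : φ ∈ squareTests U α) :
    (∀ θ, power (gaussPair θ) φ = power (gaussPair θ) (combTest α a ρ)) ∨
    ∃ bbar : ℝ, 0 < bbar ∧ ∀ b : ℝ, 0 < b → b < bbar →
      ∀ θ : ℝ × ℝ, rotate U θ 0 ^ 2 = b * ν 0 → rotate U θ 1 ^ 2 = b * ν 1 →
        power (gaussPair θ) φ < power (gaussPair θ) (combTest α a ρ) := by
  obtain ⟨⟨f, hf, hφf⟩, hφα⟩ := hφ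
  obtain ⟨⟨g, hg, hgf⟩, -⟩ := combTest_mem_squareTests hα hα' habar ha hρ h
  obtain ⟨hν0, hν1, hν⟩ := h.eigenvalues habar ha hρ
  have hU := h.orthogonal
  set F : ℝ × ℝ → ℝ := fun w => f (w.1 ^ 2, w.2 ^ 2) with hF
  set K : ℝ × ℝ → ℝ := fun w => g (w.1 ^ 2, w.2 ^ 2) with hK
  have hFt : IsTest F := ⟨hf.1.comp (by fun_prop), fun z => hf.2 _⟩
  have hKt : IsTest K := ⟨hg.1.comp (by fun_prop), fun z => hg.2 _⟩
  have pF := power_comp_squares hU hf hφf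
  have pK := power_comp_squares hU hg hgf
  -- The combined test has size exactly `α`, so the level constraint on `φ` is exactly this
  -- inequality.
  have hD0 : 0 ≤ ∫ z, (K z - F z) ∂gaussPair 0 := by
    have e := power_sub_power hKt hFt 0
    have p1 := pF 0
    have p2 := pK 0
    rw [rotatePair_zero] at p1 p2
    rw [power_combTest hα hα' habar ha hρ] at p2
    simp only [Prod.fst_zero, Prod.snd_zero, zero_mul, add_zero, Real.exp_zero, mul_one,
      ne_eq, OfNat.ofNat_ne_zero, not_false_eq_true, zero_pow, neg_zero, zero_div, one_mul] at e
    rw [← e, ← p1, ← p2]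
    linarith
  have hKr : ∀ z, K (rotatePair U z) = combTest α a ρ z := by
    intro z
    rw [hgf, rotate_zero, rotate_one]
    rfl
  have hsign : ∀ w, 0 ≤ (K w - F w) * (ν 0 * w.1 ^ 2 + ν 1 * w.2 ^ 2 - critVal α a ρ) := by
    intro w
    obtain ⟨z, rfl⟩ := rotatePair_surjective hU w
    rw [← h.combStat_eq hρ, hKr]
    exact combTest_sub_mul_nonneg (ψ := fun z => F (rotatePair U z))
      ⟨hFt.1.comp (by unfold rotatePair; fun_prop), fun z => hFt.2 _⟩ α a ρ
      (g := fun z => combStat a ρ z - critVal α a ρ)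
      (fun z hz => sub_nonneg.2 hz) (fun z hz => (sub_neg.2 hz).le) z
  have hne : ∀ᵐ w ∂gaussPair 0, ν 0 * w.1 ^ 2 + ν 1 * w.2 ^ 2 - critVal α a ρ ≠ 0 := by
    obtain ⟨h1, h2, h3⟩ := orthogonal_columns hU
    have hmap : (gaussPair 0).map (rotatePair U) = gaussPair 0 := by
      have := map_gaussPair (U 0 0) (U 1 0) (U 0 1) (U 1 1) h1 h2 h3 0
      simp only [Prod.fst_zero, Prod.snd_zero, mul_zero, add_zero] at this
      exact this
    have hms : MeasurableSet
        {w : ℝ × ℝ | ν 0 * w.1 ^ 2 + ν 1 * w.2 ^ 2 - critVal α a ρ ≠ 0} :=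
      (measurableSet_eq_fun (by fun_prop) measurable_const).compl
    rw [← hmap, ae_map_iff (by unfold rotatePair; fun_prop) hms]
    filter_upwards [ae_combStat_ne habar ha hρ (critVal α a ρ)] with z hz
    rw [← h.combStat_eq hρ]
    exact sub_ne_zero.2 hz
  rcases ae_eq_zero_or_integral_exp_pos (hKt.1.sub hFt.1) (hKt.abs_sub_le_one hFt)
    (by intro z; simp [hK, hF]) (by intro z; simp [hK, hF]) hν0 hν1 hν
    (critVal_pos hα hα' habar ha hρ).le hsign hne hD0 with h0 | ⟨bbar, hb, hpos⟩
  · left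
    intro θ
    rw [pF, pK]
    exact (power_eq_of_ae_eq h0 _).symm
  · right
    refine ⟨bbar, hb, fun b hb0 hbb θ h1 h2 => ?_⟩
    rw [rotate_zero] at h1
    rw [rotate_one] at h2
    rw [pF, pK, ← sub_pos, power_sub_power hKt hFt]
    exact mul_pos (Real.exp_pos _) (hpos b hb0 hbb (rotatePair U θ) h1 h2)

theorem isTest_of_mem_squareTests {φ : ℝ × ℝ → ℝ} (hφ : φ ∈ squareTests U α) : IsTest φ := by
  obtain ⟨⟨f, hf, hφf⟩, -⟩ := hφ
  have : φ = f ∘ fun z => (rotate U z 0 ^ 2, rotate U z 1 ^ 2) := funext hφf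
  refine ⟨?_, fun z => by rw [hφf]; exact hf.2 _⟩
  rw [this]
  simp only [rotate_zero, rotate_one]
  exact hf.1.comp (by fun_prop)

/-- Domination on a dense set extends to all means by continuity, in particular to small means along
`(√ν₀, √ν₁)`, where a competitor whose power differs anywhere loses strictly. -/
theorem isAdmissibleIn_combTest (hα : 0 < α) (hα' : α < 1) (habar : abar < 1)
    (ha : a ∈ weightSet abar) (hρ : |ρ| ≤ 1) (h : IsEigenDecomp a ρ U ν) {alt : Set (ℝ × ℝ)}
    (halt : Dense alt) : IsAdmissibleIn (squareTests U α) gaussPair alt (combTest α a ρ) := by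
  refine ⟨combTest_mem_squareTests hα hα' habar ha hρ h, ?_⟩
  rintro ⟨ψ, hψ, hge, θ, hθ, hlt⟩
  have hall : ∀ θ, power (gaussPair θ) (combTest α a ρ) ≤ power (gaussPair θ) ψ := by
    intro θ
    have hcl : IsClosed {θ | power (gaussPair θ) (combTest α a ρ) ≤ power (gaussPair θ) ψ} :=
      isClosed_le (continuous_power (isTest_combTest α a ρ))
        (continuous_power (isTest_of_mem_squareTests hψ))
    have : closure alt ⊆ {θ | power (gaussPair θ) (combTest α a ρ) ≤ power (gaussPair θ) ψ} :=
      hcl.closure_subset_iff.2 hge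
    exact this (halt θ)
  rcases power_eq_or_lt_combTest hα hα' habar ha hρ h hψ with heq | ⟨bbar, hb, hpow⟩
  · exact absurd (heq θ) hlt.ne'
  · obtain ⟨hν0, hν1, -⟩ := h.eigenvalues habar ha hρ
    obtain ⟨θ', hθ'⟩ := rotatePair_surjective h.orthogonal (√(bbar / 2 * ν 0), √(bbar / 2 * ν 1))
    have e0 : rotate U θ' 0 = √(bbar / 2 * ν 0) := by
      rw [rotate_zero]; exact congrArg Prod.fst hθ'
    have e1 : rotate U θ' 1 = √(bbar / 2 * ν 1) := by
      rw [rotate_one]; exact congrArg Prod.snd hθ'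
    have := hpow (bbar / 2) (by positivity) (by linarith) θ'
      (by rw [e0, Real.sq_sqrt (by positivity)]) (by rw [e1, Real.sq_sqrt (by positivity)])
    exact absurd (hall θ') (not_le.2 this)

end WeakIdentification

/-- The equations for `Δ` and `c` are explicitly solvable off the lines `x = 0` and `k x + y = 0`,
whose complement is dense. -/
theorem dense_weakMean {v : VarComp} (h1 : 0 < v.Φ1) (h2 : 0 < v.Ψ) (hρ : |v.rho| < 1) :
    Dense {θ | ∃ Δ c : ℝ, Δ ≠ 0 ∧ c ≠ 0 ∧ θ = v.weakMean Δ c} := by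
  have hs : 0 < √(1 - v.rho ^ 2) := Real.sqrt_pos.2 (one_sub_sq_pos hρ)
  have hA : 0 < √v.Φ1 := Real.sqrt_pos.2 h1
  have hB : 0 < √v.Ψ := Real.sqrt_pos.2 h2
  set s := √(1 - v.rho ^ 2)
  set k := v.rho * s⁻¹ with hk
  let M : ℝ × ℝ →L[ℝ] ℝ := k • ContinuousLinearMap.fst ℝ ℝ ℝ + ContinuousLinearMap.snd ℝ ℝ ℝ
  have hM : IsOpenMap M := M.isOpenMap fun y => ⟨(0, y), by simp [M]⟩
  have d1 : Dense (Prod.fst ⁻¹' {(0 : ℝ)}ᶜ : Set (ℝ × ℝ)) :=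
    (dense_compl_singleton (0 : ℝ)).preimage isOpenMap_fst
  have d2 : Dense (M ⁻¹' {(0 : ℝ)}ᶜ) := (dense_compl_singleton (0 : ℝ)).preimage hM
  have o2 : IsOpen (M ⁻¹' {(0 : ℝ)}ᶜ) := isOpen_compl_singleton.preimage M.continuous
  refine (d1.inter_of_isOpen_right d2 o2).mono ?_
  rintro ⟨x, y⟩ ⟨hx, hy⟩
  have hx : x ≠ 0 := hx
  have hy : k * x + y ≠ 0 := by simpa [M] using hy
  set w := (k * x + y) * (s * √v.Ψ) with hw
  have hw0 : w ≠ 0 := by positivity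
  -- The mean determines `Δ² c = x √Φ₁` and `Δ c = w`; the witnesses come from their quotients.
  refine ⟨x * √v.Φ1 / w, w ^ 2 / (x * √v.Φ1), by positivity, by positivity, ?_⟩
  unfold VarComp.weakMean
  ext
  · simp only; field_simp
  · simp only
    change y = s⁻¹ * (√v.Ψ)⁻¹ * (x * √v.Φ1 / w) * (w ^ 2 / (x * √v.Φ1))
      - v.rho * s⁻¹ * (√v.Φ1)⁻¹ * (x * √v.Φ1 / w) ^ 2 * (w ^ 2 / (x * √v.Φ1))
    have e1 : s⁻¹ * (√v.Ψ)⁻¹ * (x * √v.Φ1 / w) * (w ^ 2 / (x * √v.Φ1)) = k * x + y := by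
      rw [show s⁻¹ * (√v.Ψ)⁻¹ * (x * √v.Φ1 / w) * (w ^ 2 / (x * √v.Φ1))
        = s⁻¹ * (√v.Ψ)⁻¹ * w by field_simp, hw]
      field_simp
    have e2 : v.rho * s⁻¹ * (√v.Φ1)⁻¹ * (x * √v.Φ1 / w) ^ 2 * (w ^ 2 / (x * √v.Φ1)) = k * x := by
      rw [hk]
      field_simp
    rw [e1, e2]; ring

/-! ### Strong identification: local alternatives -/

theorem zero_mem_weightSet : (0 : ℝ × ℝ) ∈ weightSet 0 := by
  simp [weightSet]

theorem combStat_zero (ρ : ℝ) (z : ℝ × ℝ) : combStat 0 ρ z = z.2 ^ 2 := by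
  simp [combStat]

/-- When `ρ = 0` the second and third squares coincide, so `a₂` is immaterial. -/
theorem combTest_eq_combTest_zero {a : ℝ × ℝ} {ρ : ℝ} (h1 : a.1 = 0) (h2 : a.2 * ρ = 0) (α : ℝ) :
    combTest α a ρ = combTest α 0 ρ := by
  have h : combStat a ρ = combStat 0 ρ := by
    ext z
    rw [combStat_zero]
    unfold combStat
    rcases mul_eq_zero.1 h2 with h | h <;> simp [h, h1]
    ring
  simp only [combTest, critVal, h]

theorem combTest_zero_neg_snd (α ρ : ℝ) (z : ℝ × ℝ) :
    combTest α 0 ρ (z.1, -z.2) = combTest α 0 ρ z := by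
  simp only [combTest, Set.indicator, Set.mem_ofPred_eq, combStat_zero, neg_sq, Pi.one_apply]

theorem combTest_zero_neg (α ρ : ℝ) (z : ℝ × ℝ) :
    combTest α 0 ρ (-z.1, -z.2) = combTest α 0 ρ z := by
  simp only [combTest, Set.indicator, Set.mem_ofPred_eq, combStat_zero, neg_sq, Pi.one_apply]

theorem power_neg_snd {φ : ℝ × ℝ → ℝ} (hφ : Measurable φ) (h : ∀ z, φ (z.1, -z.2) = φ z)
    (μ : ℝ) : power (gaussPair (0, -μ)) φ = power (gaussPair (0, μ)) φ := by
  rw [power_gaussPair, power_gaussPair,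
    ← integral_comp_neg_snd (g := fun z => φ z * Real.exp _) (by fun_prop)]
  simp [h]

/-- The first mean is zero, so flipping the first coordinate preserves the law; the joint sign
change then acts on the power like a flip of the second coordinate. -/
theorem power_neg_of_neg {φ : ℝ × ℝ → ℝ} (hφ : Measurable φ) (h : ∀ z, φ (-z.1, -z.2) = φ z)
    (μ : ℝ) : power (gaussPair (0, -μ)) φ = power (gaussPair (0, μ)) φ := by
  have hm : Measurable fun z : ℝ × ℝ => φ (-z.1, z.2) := hφ.comp (by fun_prop)
  have e : power (gaussPair (0, -μ)) (fun z : ℝ × ℝ => φ (-z.1, z.2))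
      = power (gaussPair (0, -μ)) φ := by
    rw [power_gaussPair, power_gaussPair,
      ← integral_comp_neg_fst (g := fun z => φ z * Real.exp _) (by fun_prop)]
    simp
  have e' : power (gaussPair (0, -μ)) (fun z : ℝ × ℝ => φ (-z.1, z.2))
      = power (gaussPair (0, μ)) φ := by
    rw [power_gaussPair, power_gaussPair,
      ← integral_comp_neg_snd (g := fun z => φ (-z.1, z.2) * Real.exp _) (by fun_prop)]
    have : ∀ z : ℝ × ℝ, φ (-z.1, -z.2) = φ z := h
    simp [this]
  rw [← e, e']

theorem integral_eq_power_zero (φ : ℝ × ℝ → ℝ) : ∫ z, φ z ∂gaussPair 0 = power (gaussPair 0) φ :=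
  rfl

/-! ### Neyman–Pearson arguments for the two-sided test -/

section Symmetric

variable {α ρ : ℝ} {ψ : ℝ × ℝ → ℝ}

theorem integral_combTest_zero_sub (hα : 0 < α) (hα' : α < 1) (hρ : |ρ| ≤ 1) (hψ : IsTest ψ) :
    ∫ z, (combTest α 0 ρ z - ψ z) ∂gaussPair 0 = α - power (gaussPair 0) ψ := by
  have h0 := isTest_combTest α 0 ρ
  rw [integral_sub (integrable_of_abs_le_one h0.1 h0.abs_le_one)
    (integrable_of_abs_le_one hψ.1 hψ.abs_le_one), integral_eq_power_zero, integral_eq_power_zero,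
    power_combTest hα hα' zero_lt_one zero_mem_weightSet hρ]

/-- The two-sided test maximizes the sum of the powers at opposite means, essentially uniquely. -/
theorem power_add_power_neg_le (hα : 0 < α) (hα' : α < 1) (hρ : |ρ| ≤ 1) (hψ : IsTest ψ)
    (hψα : power (gaussPair 0) ψ ≤ α) {μ : ℝ} (hμ : μ ≠ 0) :
    power (gaussPair (0, μ)) ψ + power (gaussPair (0, -μ)) ψ ≤
      power (gaussPair (0, μ)) (combTest α 0 ρ) + power (gaussPair (0, -μ)) (combTest α 0 ρ) ∧
    (power (gaussPair (0, μ)) (combTest α 0 ρ) ≤ power (gaussPair (0, μ)) ψ →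
      power (gaussPair (0, -μ)) (combTest α 0 ρ) ≤ power (gaussPair (0, -μ)) ψ →
      ∀ᵐ z ∂gaussPair 0, combTest α 0 ρ z - ψ z = 0) := by
  have h0 := isTest_combTest α 0 ρ
  have hc : 0 < critVal α 0 ρ := critVal_pos hα hα' zero_lt_one zero_mem_weightSet hρ
  set c := critVal α 0 ρ with hcdef
  set φ₀ := combTest α 0 ρ with hφ₀
  -- The Neyman–Pearson threshold: the value of `exp (μ y) + exp (-μ y)` on the boundary `y² = c`.
  set k := 2 * Real.cosh (μ * √c) with hk
  set D : ℝ × ℝ → ℝ := fun z => φ₀ z - ψ z with hD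
  have hDm : Measurable D := h0.1.sub hψ.1
  have hD1 : ∀ z, |D z| ≤ 1 := h0.abs_sub_le_one hψ
  set g : ℝ × ℝ → ℝ := fun z => 2 * Real.cosh (μ * z.2) - k with hg
  have habs : ∀ y : ℝ, |√c| ≤ |y| ↔ c ≤ y ^ 2 := fun y => by
    rw [← sq_le_sq, Real.sq_sqrt hc.le]
  have hcosh : ∀ y : ℝ, Real.cosh (μ * √c) ≤ Real.cosh (μ * y) ↔ c ≤ y ^ 2 := fun y => by
    rw [Real.cosh_le_cosh, abs_mul, abs_mul, mul_le_mul_iff_right₀ (abs_pos.2 hμ), habs]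
  have hDg : ∀ z, 0 ≤ D z * g z := by
    intro z
    refine combTest_sub_mul_nonneg hψ α 0 ρ (g := g) (fun w hw => ?_) (fun w hw => ?_) z
    · rw [combStat_zero] at hw
      have := (hcosh w.2).2 hw
      simp only [hg, hk]; linarith
    · rw [combStat_zero] at hw
      have := not_le.1 (mt (hcosh w.2).1 (not_le.2 hw))
      simp only [hg, hk]; linarith
  have hgne : ∀ᵐ z ∂gaussPair 0, g z ≠ 0 := by
    filter_upwards [ae_combStat_ne zero_lt_one zero_mem_weightSet hρ c] with z hz hgz
    rw [combStat_zero] at hz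
    have e : Real.cosh (μ * √c) = Real.cosh (μ * z.2) := by
      simp only [hg, hk] at hgz; linarith
    refine hz (le_antisymm ?_ ((hcosh z.2).1 e.le))
    have := e.ge
    rw [Real.cosh_le_cosh, abs_mul, abs_mul, mul_le_mul_iff_right₀ (abs_pos.2 hμ), ← sq_le_sq,
      Real.sq_sqrt hc.le] at this
    exact this
  have i1 := integrable_mul_exp hDm hD1 0 μ
  have i2 := integrable_mul_exp hDm hD1 0 (-μ)
  have i3 := (integrable_of_abs_le_one hDm hD1).mul_const k
  have hDgeq : (fun z => D z * g z) = fun z => D z * Real.exp (0 * z.1 + μ * z.2)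
      + D z * Real.exp (0 * z.1 + -μ * z.2) - D z * k := by
    ext z
    simp only [hg, Real.cosh_eq]
    rw [zero_mul, zero_add, zero_add, neg_mul]
    ring
  have i12 : Integrable (fun z => D z * Real.exp (0 * z.1 + μ * z.2)
      + D z * Real.exp (0 * z.1 + -μ * z.2)) (gaussPair 0) := i1.add i2
  have hDgint : Integrable (fun z => D z * g z) (gaussPair 0) := by
    rw [hDgeq]; exact i12.sub i3
  have hsum : ∫ z, D z * g z ∂gaussPair 0 = ∫ z, D z * Real.exp (0 * z.1 + μ * z.2) ∂gaussPair 0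
      + ∫ z, D z * Real.exp (0 * z.1 + -μ * z.2) ∂gaussPair 0
      - (α - power (gaussPair 0) ψ) * k := by
    rw [hDgeq, integral_sub i12 i3, integral_add i1 i2, integral_mul_const,
      integral_combTest_zero_sub hα hα' hρ hψ]
  have hnn : 0 ≤ ∫ z, D z * g z ∂gaussPair 0 := integral_nonneg hDg
  have hk0 : 0 ≤ (α - power (gaussPair 0) ψ) * k :=
    mul_nonneg (sub_nonneg.2 hψα) (by have := Real.cosh_pos (μ * √c); positivity)
  have p1 := power_sub_power h0 hψ (0, μ)
  have p2 := power_sub_power h0 hψ (0, -μ)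
  simp only [neg_sq] at p1 p2
  set E := Real.exp (-((0 : ℝ) ^ 2 + μ ^ 2) / 2) with hE
  have hE0 : 0 < E := Real.exp_pos _
  set I1 := ∫ z, D z * Real.exp (0 * z.1 + μ * z.2) ∂gaussPair 0
  set I2 := ∫ z, D z * Real.exp (0 * z.1 + -μ * z.2) ∂gaussPair 0
  constructor
  · have : 0 ≤ E * (I1 + I2) := mul_nonneg hE0.le (by linarith)
    linarith
  · intro q1 q2
    refine ae_eq_zero_of_integral_mul_nonpos hDg hDgint hgne ?_
    have : E * (I1 + I2) ≤ 0 := by linarith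
    have := nonpos_of_mul_nonpos_right this hE0
    linarith

/-- Convexity of `exp` with denominators cleared; it places the exponential below its chord between
the endpoints and above it outside. -/
theorem exp_three_points (μ : ℝ) {x y z : ℝ} (hxy : x ≤ y) (hyz : y ≤ z) :
    (z - x) * Real.exp (μ * y) ≤ (z - y) * Real.exp (μ * x) + (y - x) * Real.exp (μ * z) := by
  rcases (hxy.trans hyz).eq_or_lt with h | h
  · have h1 : y = x := by linarith
    have h2 : z = x := h.symm
    simp [h1, h2]
  have hzx : 0 < z - x := sub_pos.2 h
  have := convexOn_exp.2 (Set.mem_univ (μ * x)) (Set.mem_univ (μ * z))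
    (div_nonneg (sub_nonneg.2 hyz) hzx.le) (div_nonneg (sub_nonneg.2 hxy) hzx.le)
    (by field_simp; ring)
  simp only [smul_eq_mul] at this
  rw [show (z - y) / (z - x) * (μ * x) + (y - x) / (z - x) * (μ * z) = μ * y by
    field_simp; ring] at this
  have h2 := mul_le_mul_of_nonneg_left this hzx.le
  refine h2.trans_eq ?_
  field_simp

theorem integrable_mul_snd (hψ : Measurable ψ) (hψ1 : ∀ z, |ψ z| ≤ 1) :
    Integrable (fun z => ψ z * z.2) (gaussPair 0) := by
  refine integrable_of_le_exp (by fun_prop) 1 1 fun z => ?_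
  rw [abs_mul, one_mul, one_mul]
  have h1 : |z.2| ≤ Real.exp (|z.1| + |z.2|) := by
    have := Real.add_one_le_exp (|z.1| + |z.2|)
    linarith [abs_nonneg z.1]
  calc |ψ z| * |z.2| ≤ 1 * |z.2| := by gcongr; exact hψ1 z
    _ ≤ _ := by rw [one_mul]; exact h1

theorem abs_exp_sub_one_sub_le (w : ℝ) : |Real.exp w - (1 + w)| ≤ |w| ^ 2 * Real.exp |w| := by
  have h := Complex.norm_exp_sub_sum_le_norm_mul_exp (w : ℂ) 2
  have e : Complex.exp w - ∑ m ∈ Finset.range 2, (w : ℂ) ^ m / (m.factorial : ℂ)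
      = ((Real.exp w - (1 + w) : ℝ) : ℂ) := by
    simp [Finset.sum_range_succ, Nat.factorial]
  rw [e, Complex.norm_real, Complex.norm_real] at h
  exact h

/-- A test whose power is minimal at the origin is uncorrelated with the second observation. -/
theorem integral_mul_snd_eq_zero (hψ : IsTest ψ)
    (h : ∀ μ, power (gaussPair 0) ψ ≤ power (gaussPair (0, μ)) ψ) :
    ∫ z, ψ z * z.2 ∂gaussPair 0 = 0 := by
  set J := ∫ z, ψ z * z.2 ∂gaussPair 0 with hJ
  set C := ∫ z : ℝ × ℝ, 2 * Real.exp (2 * (|z.1| + |z.2|)) ∂gaussPair 0 with hC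
  have hC0 : 0 ≤ C := integral_nonneg fun z => by positivity
  have hCint := (integrable_exp_abs_add_abs 2).const_mul 2
  have i0 := integrable_of_abs_le_one hψ.1 hψ.abs_le_one
  have i1 := integrable_mul_snd hψ.1 hψ.abs_le_one
  have key : ∀ μ : ℝ, |μ| ≤ 1 → 0 ≤ μ * J + μ ^ 2 * C := by
    intro μ hμ
    have ie := integrable_mul_exp hψ.1 hψ.abs_le_one 0 μ
    have hge : ∫ z, ψ z ∂gaussPair 0 ≤ ∫ z, ψ z * Real.exp (0 * z.1 + μ * z.2) ∂gaussPair 0 := by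
      refine (h μ).trans ?_
      rw [power_gaussPair]
      refine mul_le_of_le_one_left (integral_nonneg fun z =>
        mul_nonneg (hψ.2 z).1 (Real.exp_nonneg _)) (Real.exp_le_one_iff.2 ?_)
      simp only
      nlinarith [sq_nonneg μ]
    have hle : ∫ z, ψ z * Real.exp (0 * z.1 + μ * z.2) ∂gaussPair 0 ≤
        ∫ z, (ψ z + μ * (ψ z * z.2) + μ ^ 2 * (2 * Real.exp (2 * (|z.1| + |z.2|))))
          ∂gaussPair 0 := by
      refine integral_mono ie ((i0.add (i1.const_mul μ)).add (hCint.const_mul _)) fun z => ?_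
      simp only [zero_mul, zero_add]
      have hT := (abs_le.1 (abs_exp_sub_one_sub_le (μ * z.2))).2
      have hy : |z.2| ^ 2 ≤ 2 * Real.exp |z.2| := by
        have := Real.pow_div_factorial_le_exp |z.2| (abs_nonneg _) 2
        rw [div_le_iff₀ (by positivity)] at this
        norm_num [Nat.factorial] at this ⊢
        linarith
      have hexp : Real.exp |μ * z.2| ≤ Real.exp |z.2| := by
        rw [abs_mul]
        exact Real.exp_le_exp.2 (mul_le_of_le_one_left (abs_nonneg _) hμ)
      have hR : |μ * z.2| ^ 2 * Real.exp |μ * z.2| ≤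
          μ ^ 2 * (2 * Real.exp (2 * (|z.1| + |z.2|))) := by
        calc |μ * z.2| ^ 2 * Real.exp |μ * z.2|
            = μ ^ 2 * (|z.2| ^ 2 * Real.exp |μ * z.2|) := by
              rw [abs_mul, mul_pow, sq_abs μ]; ring
          _ ≤ μ ^ 2 * (2 * Real.exp |z.2| * Real.exp |z.2|) := by gcongr
          _ = μ ^ 2 * (2 * Real.exp (2 * |z.2|)) := by
              rw [two_mul |z.2|, Real.exp_add]; ring
          _ ≤ _ := by
              gcongr
              linarith [abs_nonneg z.1]
      have hR0 : 0 ≤ μ ^ 2 * (2 * Real.exp (2 * (|z.1| + |z.2|))) := by positivity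
      have h1 : Real.exp (μ * z.2) ≤ 1 + μ * z.2 + μ ^ 2 * (2 * Real.exp (2 * (|z.1| + |z.2|))) := by
        linarith
      nlinarith [mul_le_mul_of_nonneg_left h1 (hψ.2 z).1,
        mul_le_mul_of_nonneg_right (hψ.2 z).2 hR0]
    have hA : Integrable (fun z => ψ z + μ * (ψ z * z.2)) (gaussPair 0) := i0.add (i1.const_mul μ)
    rw [integral_add hA (hCint.const_mul _), integral_add i0 (i1.const_mul μ), integral_const_mul,
      integral_const_mul] at hle
    linarith
  by_contra hne
  have hJ0 : 0 < |J| := abs_pos.2 hne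
  -- This size gives `s |J| ≤ 1` and `s C < 1`; then `μ = -s J` turns the bound into `-s J² (1 - s
  -- C) < 0`.
  set s := 1 / ((C + 1) * (|J| + 1)) with hs
  have hs0 : 0 < s := by positivity
  have hsJ : s * |J| ≤ 1 := by
    rw [hs, one_div, inv_mul_le_iff₀ (by positivity)]
    nlinarith
  have hsC : s * C < 1 := by
    rw [hs, one_div, inv_mul_lt_iff₀ (by positivity)]
    nlinarith
  have := key (-s * J) (by rw [abs_mul, abs_neg, abs_of_pos hs0]; exact hsJ)
  have hJJ : 0 < J ^ 2 := by positivity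
  nlinarith [mul_pos hs0 (mul_pos hJJ (sub_pos.2 hsC))]

/-- The two-sided test dominates the unbiased tests. -/
theorem power_le_of_unbiased (hα : 0 < α) (hα' : α < 1) (hρ : |ρ| ≤ 1) (hψ : IsTest ψ)
    (hψα : power (gaussPair 0) ψ ≤ α) (hunb : ∀ μ, μ ≠ 0 → α ≤ power (gaussPair (0, μ)) ψ)
    (μ : ℝ) : power (gaussPair (0, μ)) ψ ≤ power (gaussPair (0, μ)) (combTest α 0 ρ) := by
  have h0 := isTest_combTest α 0 ρ
  have hc : 0 < critVal α 0 ρ := critVal_pos hα hα' zero_lt_one zero_mem_weightSet hρ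
  -- Continuity extends unbiasedness to the origin, so the size is exactly `α` and the power is
  -- minimal there.
  have hge : ∀ μ, α ≤ power (gaussPair (0, μ)) ψ := by
    have hcont : Continuous fun μ : ℝ => power (gaussPair (0, μ)) ψ :=
      (continuous_power hψ).comp (by fun_prop)
    intro μ
    have hcl : IsClosed {μ : ℝ | α ≤ power (gaussPair (0, μ)) ψ} :=
      isClosed_le continuous_const hcont
    have hsub : closure ({0}ᶜ : Set ℝ) ⊆ {μ : ℝ | α ≤ power (gaussPair (0, μ)) ψ} :=
      hcl.closure_subset_iff.2 fun μ hμ => hunb μ hμ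
    exact hsub (dense_compl_singleton (0 : ℝ) μ)
  have hαeq : power (gaussPair 0) ψ = α := le_antisymm hψα (hge 0)
  have hJ := integral_mul_snd_eq_zero hψ fun μ => hψα.trans (hge μ)
  have hJ0 : ∫ z, combTest α 0 ρ z * z.2 ∂gaussPair 0 = 0 := by
    have := integral_comp_neg_snd (g := fun z => combTest α 0 ρ z * z.2) (h0.1.mul measurable_snd)
    simp only [combTest_zero_neg_snd, mul_neg] at this
    rw [integral_neg] at this
    linarith
  set c := critVal α 0 ρ with hcdef
  set t := √c with ht
  have ht0 : 0 < t := Real.sqrt_pos.2 hc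
  have ht2 : t ^ 2 = c := Real.sq_sqrt hc.le
  set p := Real.exp (μ * t)
  set q := Real.exp (μ * -t)
  -- `g` is `2t` times the gap between `exp (μ y)` and its chord through `±t`. The constant and
  -- linear parts of the chord integrate to zero against `D`.
  set g : ℝ × ℝ → ℝ := fun z => 2 * t * Real.exp (0 * z.1 + μ * z.2) - (p + q) * t - (p - q) * z.2
    with hg
  set D : ℝ × ℝ → ℝ := fun z => combTest α 0 ρ z - ψ z with hD
  have hDm : Measurable D := h0.1.sub hψ.1
  have hD1 : ∀ z, |D z| ≤ 1 := h0.abs_sub_le_one hψ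
  have hDg : ∀ z, 0 ≤ D z * g z := by
    intro z
    refine combTest_sub_mul_nonneg hψ α 0 ρ (g := g) (fun w hw => ?_) (fun w hw => ?_) z
    · rw [combStat_zero, ← hcdef, ← ht2, sq_le_sq, abs_of_pos ht0] at hw
      simp only [hg, zero_mul, zero_add]
      rcases le_abs.1 hw with h | h
      · have := exp_three_points μ (by linarith : -t ≤ t) h
        linarith
      · have := exp_three_points μ (by linarith : w.2 ≤ -t) (by linarith : -t ≤ t)
        linarith
    · rw [combStat_zero, ← hcdef, ← ht2, sq_lt_sq, abs_of_pos ht0, abs_lt] at hw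
      have := exp_three_points μ hw.1.le hw.2.le
      simp only [hg, zero_mul, zero_add]
      linarith
  have i0 := integrable_of_abs_le_one hDm hD1
  have i1 := integrable_mul_exp hDm hD1 0 μ
  have i2 := integrable_mul_snd hDm hD1
  have hDgeq : (fun z => D z * g z) = fun z => 2 * t * (D z * Real.exp (0 * z.1 + μ * z.2))
      - (p + q) * t * D z - (p - q) * (D z * z.2) := by
    ext z; simp only [hg]; ring
  have i01 : Integrable (fun z => 2 * t * (D z * Real.exp (0 * z.1 + μ * z.2))
      - (p + q) * t * D z) (gaussPair 0) := (i1.const_mul _).sub (i0.const_mul _)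
  have hD0 : ∫ z, D z ∂gaussPair 0 = 0 := by
    rw [integral_combTest_zero_sub hα hα' hρ hψ, hαeq, sub_self]
  have hDy : ∫ z, D z * z.2 ∂gaussPair 0 = 0 := by
    simp only [hD, sub_mul]
    rw [integral_sub (integrable_mul_snd h0.1 h0.abs_le_one)
      (integrable_mul_snd hψ.1 hψ.abs_le_one), hJ, hJ0, sub_self]
  have hnn : 0 ≤ ∫ z, D z * g z ∂gaussPair 0 := integral_nonneg hDg
  rw [hDgeq, integral_sub i01 (i2.const_mul _), integral_sub (i1.const_mul _) (i0.const_mul _),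
    integral_const_mul, integral_const_mul, integral_const_mul, hD0, hDy, mul_zero, mul_zero,
    sub_zero, sub_zero] at hnn
  rw [← sub_nonneg, power_sub_power h0 hψ]
  exact mul_nonneg (Real.exp_nonneg _) (nonneg_of_mul_nonneg_right hnn (by positivity))

end Symmetric

/-- A combined test that agrees with the two-sided test puts no weight on the first observation. -/
theorem weights_of_ae_eq {α abar : ℝ} (hα : 0 < α) (hα' : α < 1) (habar : abar < 1) {a : ℝ × ℝ}
    (ha : a ∈ weightSet abar) {ρ : ℝ} (hρ : |ρ| ≤ 1)
    (h : ∀ᵐ z ∂gaussPair 0, combTest α 0 ρ z - combTest α a ρ z = 0) :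
    a.1 = 0 ∧ a.2 * ρ = 0 := by
  have hc0 : 0 < critVal α 0 ρ := critVal_pos hα hα' zero_lt_one zero_mem_weightSet hρ
  have hc : 0 < critVal α a ρ := critVal_pos hα hα' habar ha hρ
  have ha1 := ha.1.1
  have ha2 : 0 ≤ a.2 * ρ ^ 2 := mul_nonneg ha.2.1.1 (sq_nonneg ρ)
  by_cases hp : a.1 + a.2 * ρ ^ 2 = 0
  · have e1 : a.1 = 0 := by linarith
    have e2 : a.2 * ρ ^ 2 = 0 := by linarith
    refine ⟨e1, ?_⟩
    rcases mul_eq_zero.1 e2 with h | h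
    · simp [h]
    · simp [pow_eq_zero_iff two_ne_zero |>.1 h]
  exfalso
  have hp : 0 < a.1 + a.2 * ρ ^ 2 := lt_of_le_of_ne (by linarith) (Ne.symm hp)
  -- On this open set the combined test rejects and the two-sided test does not; it contains a
  -- distant point of the first axis.
  set V : Set (ℝ × ℝ) := {z | critVal α a ρ < combStat a ρ z} ∩ {z | combStat 0 ρ z < critVal α 0 ρ}
    with hV
  have hVo : IsOpen V :=
    (isOpen_lt continuous_const (continuous_combStat a ρ)).inter
      (isOpen_lt (continuous_combStat 0 ρ) continuous_const)
  have hVne : V.Nonempty := by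
    refine ⟨(√((critVal α a ρ + 1) / (a.1 + a.2 * ρ ^ 2)), 0), ?_, ?_⟩
    · change critVal α a ρ < combStat a ρ _
      rw [combStat_eq hρ]
      simp only
      rw [Real.sq_sqrt (by positivity), mul_div_cancel₀ _ hp.ne']
      linarith
    · change combStat 0 ρ _ < _
      rw [combStat_zero]
      simpa using hc0
  have hV0 : gaussPair 0 V = 0 := by
    refine measure_mono_null (fun z hz => ?_) (ae_iff.1 h)
    have hz1 : critVal α a ρ < combStat a ρ z := hz.1
    have hz2 : combStat 0 ρ z < critVal α 0 ρ := hz.2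
    have e1 : combTest α a ρ z = 1 := by
      unfold combTest
      rw [Set.indicator_of_mem (by exact hz1.le)]; rfl
    have e2 : combTest α 0 ρ z = 0 := by
      unfold combTest
      rw [Set.indicator_of_notMem (by exact not_le.2 hz2)]
    simp [e1, e2]
  exact (hVo.measure_pos _ hVne).ne' hV0

/-! ### Passing to independent coordinates -/

/-- The inverse of `orthogonalize ρ`. -/
noncomputable def correlate (ρ : ℝ) (z : ℝ × ℝ) : ℝ × ℝ := (z.1, ρ * z.1 + √(1 - ρ ^ 2) * z.2)

section Local

variable {α ρ : ℝ}

theorem correlate_orthogonalize (hρ : |ρ| < 1) (z : ℝ × ℝ) :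
    correlate ρ (orthogonalize ρ z) = z := by
  have hs : √(1 - ρ ^ 2) ≠ 0 := (Real.sqrt_pos.2 (one_sub_sq_pos hρ)).ne'
  unfold correlate orthogonalize
  ext
  · rfl
  · simp only; field_simp; ring

theorem power_localLaw_comp (hρ : |ρ| < 1) {g : ℝ × ℝ → ℝ} (hg : Measurable g) (θ : ℝ) :
    power (localLaw ρ θ) (fun z => g (orthogonalize ρ z)) =
      power (gaussPair (0, (√(1 - ρ ^ 2))⁻¹ * θ)) g := by
  unfold power
  rw [← map_orthogonalize_localLaw hρ θ,
    integral_map (by unfold orthogonalize; fun_prop) hg.aestronglyMeasurable]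

theorem IsTest.comp_correlate {ψ : ℝ × ℝ → ℝ} (hψ : IsTest ψ) (ρ : ℝ) :
    IsTest (fun z => ψ (correlate ρ z)) :=
  ⟨hψ.1.comp (by unfold correlate; fun_prop), fun _ => hψ.2 _⟩

theorem power_localLaw (hρ : |ρ| < 1) {ψ : ℝ × ℝ → ℝ} (hψ : IsTest ψ) (θ : ℝ) :
    power (localLaw ρ θ) ψ =
      power (gaussPair (0, (√(1 - ρ ^ 2))⁻¹ * θ)) (fun z => ψ (correlate ρ z)) := by
  rw [← power_localLaw_comp hρ (hψ.comp_correlate ρ).1]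
  simp only [correlate_orthogonalize hρ]

theorem power_localLaw_zero (hρ : |ρ| < 1) {ψ : ℝ × ℝ → ℝ} (hψ : IsTest ψ) :
    power (localLaw ρ 0) ψ = power (gaussPair 0) (fun z => ψ (correlate ρ z)) := by
  rw [power_localLaw hρ hψ, mul_zero]; rfl

theorem isTest_combTestLocal (α : ℝ) (a : ℝ × ℝ) (ρ : ℝ) : IsTest (combTestLocal α a ρ) :=
  ⟨(isTest_combTest α a ρ).1.comp (by unfold orthogonalize; fun_prop),
    fun _ => (isTest_combTest α a ρ).2 _⟩

theorem power_combTestLocal (hρ : |ρ| < 1) (a : ℝ × ℝ) (θ : ℝ) :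
    power (localLaw ρ θ) (combTestLocal α a ρ) =
      power (gaussPair (0, (√(1 - ρ ^ 2))⁻¹ * θ)) (combTest α a ρ) :=
  power_localLaw_comp hρ (isTest_combTest α a ρ).1 θ

theorem combTestLocal_zero_mem_levelTests (hα : 0 < α) (hα' : α < 1) (hρ : |ρ| < 1) :
    combTestLocal α 0 ρ ∈ levelTests ρ α := by
  refine ⟨isTest_combTestLocal α 0 ρ, ?_⟩
  rw [power_combTestLocal hρ, mul_zero]
  exact (power_combTest hα hα' zero_lt_one zero_mem_weightSet hρ.le).le

theorem combTestLocal_zero_mem_invariantTests_flipOrth (hα : 0 < α) (hα' : α < 1)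
    (hρ : |ρ| < 1) : combTestLocal α 0 ρ ∈ invariantTests ρ α (flipOrth ρ) := by
  refine ⟨combTestLocal_zero_mem_levelTests hα hα' hρ, fun z => ?_⟩
  unfold combTestLocal
  rw [orthogonalize_flipOrth, combTest_zero_neg_snd]

theorem orthogonalize_flipBoth (ρ : ℝ) (z : ℝ × ℝ) :
    orthogonalize ρ (flipBoth z) = (-(orthogonalize ρ z).1, -(orthogonalize ρ z).2) := by
  simp only [orthogonalize, flipBoth, Prod.mk.injEq, true_and]
  ring

theorem combTestLocal_zero_mem_invariantTests_flipBoth (hα : 0 < α) (hα' : α < 1)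
    (hρ : |ρ| < 1) : combTestLocal α 0 ρ ∈ invariantTests ρ α flipBoth := by
  refine ⟨combTestLocal_zero_mem_levelTests hα hα' hρ, fun z => ?_⟩
  unfold combTestLocal
  rw [orthogonalize_flipBoth, combTest_zero_neg]

/-- The two-sided test dominates every level-`α` test whose power is an even function of the
mean. -/
theorem power_le_of_even (hα : 0 < α) (hα' : α < 1) (hρ : |ρ| ≤ 1) {ψ : ℝ × ℝ → ℝ}
    (hψ : IsTest ψ) (hψα : power (gaussPair 0) ψ ≤ α) {μ : ℝ} (hμ : μ ≠ 0)
    (he : power (gaussPair (0, -μ)) ψ = power (gaussPair (0, μ)) ψ) :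
    power (gaussPair (0, μ)) ψ ≤ power (gaussPair (0, μ)) (combTest α 0 ρ) := by
  have h := (power_add_power_neg_le hα hα' hρ hψ hψα hμ).1
  rw [he, power_neg_snd (isTest_combTest α 0 ρ).1 (combTest_zero_neg_snd α ρ)] at h
  linarith

/-- The constant test `α` has even power, so the two-sided test dominates it. -/
theorem combTestLocal_zero_mem_unbiasedTests (hα : 0 < α) (hα' : α < 1)
    (hρ : |ρ| < 1) : combTestLocal α 0 ρ ∈ unbiasedTests ρ α := by
  refine ⟨combTestLocal_zero_mem_levelTests hα hα' hρ, fun θ hθ => ?_⟩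
  rw [power_combTestLocal hρ]
  have hs : (√(1 - ρ ^ 2))⁻¹ ≠ 0 := inv_ne_zero (Real.sqrt_pos.2 (one_sub_sq_pos hρ)).ne'
  have hconst : ∀ ϑ, power (gaussPair ϑ) (fun _ => α) = α := fun ϑ => by simp [power]
  have := power_le_of_even hα hα' hρ.le (ψ := fun _ => α)
    ⟨measurable_const, fun _ => ⟨hα.le, hα'.le⟩⟩ (hconst 0).le (mul_ne_zero hs hθ)
    (by rw [hconst, hconst])
  rwa [hconst] at this

theorem powerDominates_flipOrth (hα : 0 < α) (hα' : α < 1) (hρ : |ρ| < 1) :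
    PowerDominates (invariantTests ρ α (flipOrth ρ)) (localLaw ρ) {θ | θ ≠ 0}
      (combTestLocal α 0 ρ) := by
  rintro ψ ⟨⟨hψ, hψα⟩, hinv⟩ θ hθ
  have hs : (√(1 - ρ ^ 2))⁻¹ ≠ 0 := inv_ne_zero (Real.sqrt_pos.2 (one_sub_sq_pos hρ)).ne'
  rw [power_localLaw_zero hρ hψ] at hψα
  rw [power_combTestLocal hρ, power_localLaw hρ hψ]
  refine power_le_of_even hα hα' hρ.le (hψ.comp_correlate ρ) hψα (mul_ne_zero hs hθ)
    (power_neg_snd (hψ.comp_correlate ρ).1 (fun z => ?_) _)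
  rw [← hinv (correlate ρ z)]
  congr 1
  simp only [correlate, flipOrth, Prod.mk.injEq, true_and]
  ring

theorem powerDominates_flipBoth (hα : 0 < α) (hα' : α < 1) (hρ : |ρ| < 1) :
    PowerDominates (invariantTests ρ α flipBoth) (localLaw ρ) {θ | θ ≠ 0}
      (combTestLocal α 0 ρ) := by
  rintro ψ ⟨⟨hψ, hψα⟩, hinv⟩ θ hθ
  have hs : (√(1 - ρ ^ 2))⁻¹ ≠ 0 := inv_ne_zero (Real.sqrt_pos.2 (one_sub_sq_pos hρ)).ne'
  rw [power_localLaw_zero hρ hψ] at hψα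
  rw [power_combTestLocal hρ, power_localLaw hρ hψ]
  refine power_le_of_even hα hα' hρ.le (hψ.comp_correlate ρ) hψα (mul_ne_zero hs hθ)
    (power_neg_of_neg (hψ.comp_correlate ρ).1 (fun z => ?_) _)
  rw [← hinv (correlate ρ z)]
  congr 1
  simp only [correlate, flipBoth, Prod.mk.injEq, true_and]
  ring

theorem powerDominates_unbiased (hα : 0 < α) (hα' : α < 1) (hρ : |ρ| < 1) :
    PowerDominates (unbiasedTests ρ α) (localLaw ρ) {θ | θ ≠ 0} (combTestLocal α 0 ρ) := by
  rintro ψ ⟨⟨hψ, hψα⟩, hunb⟩ θ hθ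
  have hs : √(1 - ρ ^ 2) ≠ 0 := (Real.sqrt_pos.2 (one_sub_sq_pos hρ)).ne'
  rw [power_localLaw_zero hρ hψ] at hψα
  rw [power_combTestLocal hρ, power_localLaw hρ hψ]
  refine power_le_of_unbiased hα hα' hρ.le (hψ.comp_correlate ρ) hψα (fun μ hμ => ?_) _
  have := hunb (√(1 - ρ ^ 2) * μ) (mul_ne_zero hs hμ)
  rwa [power_localLaw hρ hψ, inv_mul_cancel_left₀ hs] at this

/-- A combined test that dominates the two-sided test puts no weight on the first observation. -/
theorem weights_of_powerDominates (hα : 0 < α) (hα' : α < 1) {abar : ℝ} (habar : abar < 1)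
    {a : ℝ × ℝ} (ha : a ∈ weightSet abar) (hρ : |ρ| < 1) {T : Set (ℝ × ℝ → ℝ)}
    (hT : combTestLocal α 0 ρ ∈ T)
    (h : PowerDominates T (localLaw ρ) {θ | θ ≠ 0} (combTestLocal α a ρ)) :
    a.1 = 0 ∧ a.2 * ρ = 0 := by
  have hs : √(1 - ρ ^ 2) ≠ 0 := (Real.sqrt_pos.2 (one_sub_sq_pos hρ)).ne'
  have key : ∀ μ, μ ≠ 0 → power (gaussPair (0, μ)) (combTest α 0 ρ) ≤
      power (gaussPair (0, μ)) (combTest α a ρ) := by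
    intro μ hμ
    have := h _ hT (√(1 - ρ ^ 2) * μ) (mul_ne_zero hs hμ)
    rwa [power_combTestLocal hρ, power_combTestLocal hρ, inv_mul_cancel_left₀ hs] at this
  refine weights_of_ae_eq hα hα' habar ha hρ.le ?_
  -- Means `±1` suffice: at least equal power at both invokes the equality case.
  exact (power_add_power_neg_le hα hα' hρ.le (isTest_combTest α a ρ)
    (power_combTest hα hα' habar ha hρ.le).le one_ne_zero).2 (key 1 one_ne_zero)
    (key (-1) (by norm_num))

theorem combTestLocal_eq {a : ℝ × ℝ} (h : a.1 = 0 ∧ a.2 * ρ = 0) :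
    combTestLocal α a ρ = combTestLocal α 0 ρ := by
  unfold combTestLocal
  rw [combTest_eq_combTest_zero h.1 h.2]

end Local

/-! ### Critical values, uniformly in the weights -/

section CriticalValues

variable {α abar : ℝ}

/-- The mass below the critical value is `1 - α`, and the open band up to `q` adds positive mass.
The strict inequality leaves room to perturb weights and correlation. -/
theorem measureReal_combStat_lt {a : ℝ × ℝ} {ρ q : ℝ} (hα : 0 < α) (hα' : α < 1)
    (habar : abar < 1) (ha : a ∈ weightSet abar) (hρ : |ρ| ≤ 1) (hq : critVal α a ρ < q) :
    1 - α < (gaussPair 0).real {z | combStat a ρ z < q} := by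
  set c := critVal α a ρ with hc
  have hc0 : 0 < c := critVal_pos hα hα' habar ha hρ
  have hm := measurable_combStat a ρ
  have hp := power_combTest hα hα' habar ha hρ
  have hms : MeasurableSet {z | c ≤ combStat a ρ z} := measurableSet_le measurable_const hm
  unfold power combTest at hp
  rw [integral_indicator_one (by exact hms)] at hp
  have hlow : (gaussPair 0).real {z | combStat a ρ z < c} = 1 - α := by
    rw [← hp, ← probReal_compl_eq_one_sub hms]
    congr 1
    ext z
    simp [hc]
  set V := {z | c < combStat a ρ z} ∩ {z | combStat a ρ z < q} with hV
  have hVo : IsOpen V := (isOpen_lt continuous_const (continuous_combStat a ρ)).inter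
    (isOpen_lt (continuous_combStat a ρ) continuous_const)
  have hVne : V.Nonempty := by
    have hlead : 0 < 1 - a.1 - a.2 * ρ ^ 2 := by
      obtain ⟨⟨h1, -⟩, ⟨h2, -⟩, h3⟩ := ha
      have := (sq_le_one_iff_abs_le_one ρ).2 hρ
      nlinarith [mul_le_mul_of_nonneg_left this h2]
    have hval : combStat a ρ (0, √((c + q) / 2 / (1 - a.1 - a.2 * ρ ^ 2))) = (c + q) / 2 := by
      rw [combStat_eq hρ]
      simp only
      rw [Real.sq_sqrt (div_nonneg (by linarith) hlead.le), mul_div_cancel₀ _ hlead.ne']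
      ring
    refine ⟨(0, √((c + q) / 2 / (1 - a.1 - a.2 * ρ ^ 2))), ?_, ?_⟩
    · change c < combStat a ρ _
      rw [hval]; linarith
    · change combStat a ρ _ < q
      rw [hval]; linarith
  have hVpos : 0 < (gaussPair 0).real V :=
    ENNReal.toReal_pos (hVo.measure_pos _ hVne).ne' (measure_ne_top _ _)
  have hdisj : Disjoint {z | combStat a ρ z < c} V :=
    Set.disjoint_left.2 fun z (h1 : combStat a ρ z < c) h2 => by
      have h2 : c < combStat a ρ z := h2.1
      linarith
  have hunion := measureReal_union (μ := gaussPair 0) hdisj hVo.measurableSet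
  have hmono : (gaussPair 0).real ({z | combStat a ρ z < c} ∪ V) ≤
      (gaussPair 0).real {z | combStat a ρ z < q} := by
    refine measureReal_mono ?_
    rintro z (hz | hz)
    · exact lt_trans (show combStat a ρ z < c from hz) hq
    · exact hz.2
  linarith

theorem critVal_le_of_measureReal {a : ℝ × ℝ} {ρ q : ℝ} (hα' : α < 1)
    (h : 1 - α ≤ (gaussPair 0).real {z | combStat a ρ z ≤ q}) : critVal α a ρ ≤ q := by
  have hm := measurable_combStat a ρ
  have : IsProbabilityMeasure ((gaussPair 0).map (combStat a ρ)) :=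
    Measure.isProbabilityMeasure_map hm.aemeasurable
  refine quantile_le (by linarith) ?_
  rwa [map_measureReal_apply hm measurableSet_Iic]

/-- Every statistic is at most `x² + y²`, whose law does not involve the weights or the correlation.
-/
theorem exists_critVal_le (hα : 0 < α) (hα' : α < 1) (habar : abar < 1) :
    ∃ M : ℝ, ∀ a ∈ weightSet abar, ∀ ρ : ℝ, |ρ| ≤ 1 → critVal α a ρ ≤ M := by
  have hm : Measurable fun z : ℝ × ℝ => z.1 ^ 2 + z.2 ^ 2 := by fun_prop
  have : IsProbabilityMeasure ((gaussPair 0).map fun z : ℝ × ℝ => z.1 ^ 2 + z.2 ^ 2) :=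
    Measure.isProbabilityMeasure_map hm.aemeasurable
  have h := (tendsto_cdf_atTop ((gaussPair 0).map fun z : ℝ × ℝ => z.1 ^ 2 + z.2 ^ 2)).eventually
    (lt_mem_nhds (by linarith : 1 - α < 1))
  obtain ⟨M, hM⟩ := h.exists
  rw [cdf_eq_real, map_measureReal_apply hm measurableSet_Iic] at hM
  refine ⟨M, fun a ha ρ hρ => critVal_le_of_measureReal hα' (hM.le.trans (measureReal_mono ?_))⟩
  exact fun z hz => (combStat_le habar ha hρ z).trans hz

theorem isCompact_weightSet (abar : ℝ) : IsCompact (weightSet abar) := by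
  refine (isCompact_Icc.prod isCompact_Icc : IsCompact
    (Set.Icc (0 : ℝ) 1 ×ˢ Set.Icc (0 : ℝ) 1)).of_isClosed_subset ?_ fun a ha => ⟨ha.1, ha.2.1⟩
  exact (isClosed_Icc.preimage continuous_fst).inter ((isClosed_Icc.preimage continuous_snd).inter
    (isClosed_le (continuous_fst.add continuous_snd) continuous_const))

/-- The critical values at correlations near `ρ` do not exceed any bound above the largest critical
value at `ρ`, uniformly in the weights. -/
theorem eventually_critVal_le {ρ q : ℝ} (hα : 0 < α) (hα' : α < 1) (habar : abar < 1)
    (hρ : |ρ| ≤ 1) (hq : critMax α abar ρ < q) :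
    ∀ᶠ ρ' in 𝓝 ρ, ∀ a ∈ weightSet abar, critVal α a ρ' ≤ q := by
  obtain ⟨M, hM⟩ := exists_critVal_le hα hα' habar
  have hlt : ∀ a ∈ weightSet abar, critVal α a ρ < q := fun a ha =>
    lt_of_le_of_lt (le_csSup ⟨M, by rintro _ ⟨a, ha, rfl⟩; exact hM a ha ρ hρ⟩
      (Set.mem_image_of_mem (fun a => critVal α a ρ) ha)) hq
  have hcont : Continuous fun p : ((ℝ × ℝ) × ℝ) × (ℝ × ℝ) => combStat p.1.1 p.1.2 p.2 := by
    unfold combStat; fun_prop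
  have hnear : ∀ a ∈ weightSet abar,
      ∀ᶠ p : (ℝ × ℝ) × ℝ in 𝓝 (a, ρ), critVal α p.1 p.2 ≤ q := by
    intro a ha
    have h1 := measureReal_combStat_lt hα hα' habar ha hρ (hlt a ha)
    have hopen : IsOpen {z | combStat a ρ z < q} :=
      isOpen_lt (continuous_combStat a ρ) continuous_const
    have h2 : ENNReal.ofReal (1 - α) < gaussPair 0 {z | combStat a ρ z < q} := by
      rw [ENNReal.ofReal_lt_iff_lt_toReal (by linarith) (measure_ne_top _ _)]
      exact h1
    -- Inner regularity gives a compact set still of mass above `1 - α`; the tube lemma keeps the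
    -- statistic below `q` on all of it for nearby parameters.
    obtain ⟨S, hSsub, hS, hSlt⟩ := hopen.exists_lt_isCompact h2
    obtain ⟨u, w, hu, -, hau, hSw, huw⟩ := generalized_tube_lemma
      (isCompact_singleton (x := (a, ρ))) hS (isOpen_lt hcont continuous_const)
      (n := {p : ((ℝ × ℝ) × ℝ) × (ℝ × ℝ) | combStat p.1.1 p.1.2 p.2 < q})
      (by rintro ⟨p, z⟩ ⟨hp, hz⟩
          rw [Set.mem_singleton_iff] at hp
          have := hSsub hz
          subst hp
          exact this)
    filter_upwards [hu.mem_nhds (hau rfl)] with p hp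
    refine critVal_le_of_measureReal hα' ?_
    rw [ENNReal.ofReal_lt_iff_lt_toReal (by linarith) (measure_ne_top _ _)] at hSlt
    refine hSlt.le.trans (measureReal_mono fun z hz => ?_)
    have : combStat p.1 p.2 z < q := huw (show (p, z) ∈ u ×ˢ w from ⟨hp, hSw hz⟩)
    exact this.le
  -- A second tube, over the compact weight set, makes the neighbourhood of `ρ` independent of the
  -- weights.
  obtain ⟨u, w, -, hw, hu, hρw, huw⟩ := generalized_tube_lemma (isCompact_weightSet abar)
    (isCompact_singleton (x := ρ)) (isOpen_interior
      (s := {p : (ℝ × ℝ) × ℝ | critVal α p.1 p.2 ≤ q}))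
    (by rintro ⟨a, r⟩ ⟨ha, hr⟩
        rw [Set.mem_singleton_iff] at hr
        simp only at ha hr
        subst hr
        exact mem_interior_iff_mem_nhds.2 (hnear a ha))
  filter_upwards [hw.mem_nhds (hρw rfl)] with r hr a ha
  have : (a, r) ∈ {p : (ℝ × ℝ) × ℝ | critVal α p.1 p.2 ≤ q} :=
    interior_subset (huw (show (a, r) ∈ u ×ˢ w from ⟨hu ha, hr⟩))
  exact this

end CriticalValues

/-! ### Strong identification: fixed alternatives -/

/-- The orthogonalized statistic, divided by the concentration parameter, as a function of the
normalized statistics `x`, `y` and of estimates `f`, `p`, `r` of `Φ₁`, `Ψ`, `ρ`. -/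
noncomputable def normalizedLMstar (x y f p r : ℝ) : ℝ :=
  (√(1 - r ^ 2))⁻¹ * (y / √p - r * (x / √f))

theorem continuousAt_normalizedLMstar {x y f p r : ℝ} (hf : 0 < f) (hp : 0 < p) (hr : |r| < 1) :
    ContinuousAt (fun w : ℝ × ℝ × ℝ × ℝ × ℝ =>
      normalizedLMstar w.1 w.2.1 w.2.2.1 w.2.2.2.1 w.2.2.2.2) (x, y, f, p, r) := by
  have h1 : √(1 - r ^ 2) ≠ 0 := (Real.sqrt_pos.2 (one_sub_sq_pos hr)).ne'
  have h2 : √f ≠ 0 := (Real.sqrt_pos.2 hf).ne'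
  have h3 : √p ≠ 0 := (Real.sqrt_pos.2 hp).ne'
  unfold normalizedLMstar
  refine ContinuousAt.mul (ContinuousAt.inv₀ (by fun_prop) h1)
    (ContinuousAt.sub (ContinuousAt.div (by fun_prop) (by fun_prop) h3)
      (ContinuousAt.mul (by fun_prop) (ContinuousAt.div (by fun_prop) (by fun_prop) h2)))

/-- The orthogonalized statistic loses its drift only at the exceptional alternative. -/
theorem eq_deltaStar_of_normalizedLMstar_eq_zero {v : VarComp} (h1 : 0 < v.Φ1) (h2 : 0 < v.Ψ)
    (hρ : |v.rho| < 1) {Δ : ℝ} (hΔ : Δ ≠ 0)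
    (h : normalizedLMstar (Δ ^ 2) Δ v.Φ1 v.Ψ v.rho = 0) : Δ = v.deltaStar := by
  have hs : (√(1 - v.rho ^ 2))⁻¹ ≠ 0 := inv_ne_zero (Real.sqrt_pos.2 (one_sub_sq_pos hρ)).ne'
  have hA : √v.Φ1 ≠ 0 := (Real.sqrt_pos.2 h1).ne'
  have hB : √v.Ψ ≠ 0 := (Real.sqrt_pos.2 h2).ne'
  have h0 := (mul_eq_zero.1 h).resolve_left hs
  have h3 : √v.Φ1 = v.rho * Δ * √v.Ψ := by
    field_simp at h0
    have : Δ * (√v.Φ1 - v.rho * Δ * √v.Ψ) = 0 := by linear_combination h0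
    linarith [(mul_eq_zero.1 this).resolve_left hΔ]
  have hr : v.rho ≠ 0 := fun h => hA (by rw [h3, h]; simp)
  unfold VarComp.deltaStar
  rw [h3]
  field_simp

/-- Rejection for all normalized statistics and estimates near their limits, once the
concentration parameter is large. -/
theorem exists_eventually_critVal_le_stat {α abar q : ℝ} (hα : 0 < α) (hα' : α < 1)
    (habar : abar < 1) {v : VarComp} (h1 : 0 < v.Φ1) (h2 : 0 < v.Ψ) (hρ : |v.rho| < 1) {Δ : ℝ}
    (hΔ : Δ ≠ 0) (hq : critMax α abar v.rho < q) :
    ∃ N : ℝ, ∀ᶠ w : ℝ × ℝ × ℝ × ℝ × ℝ in 𝓝 (Δ ^ 2, Δ, v.Φ1, v.Ψ, v.rho),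
      ∀ C : ℝ, N ≤ |C| → C ≠ 0 → ∀ a ∈ weightSet abar,
        q * v.Φ1 / (C ^ 2 * v.deltaStar ^ 4) ≤ a.1 →
        critVal α a w.2.2.2.2 ≤ a.1 * (C * w.1 / √w.2.2.1) ^ 2
          + a.2 * (C * w.2.1 / √w.2.2.2.1) ^ 2 + (1 - a.1 - a.2) *
            (C * normalizedLMstar w.1 w.2.1 w.2.2.1 w.2.2.2.1 w.2.2.2.2) ^ 2 := by
  have hcont := continuousAt_normalizedLMstar (x := Δ ^ 2) (y := Δ) h1 h2 hρ
  have hr : Tendsto (fun w : ℝ × ℝ × ℝ × ℝ × ℝ => w.2.2.2.2)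
      (𝓝 (Δ ^ 2, Δ, v.Φ1, v.Ψ, v.rho)) (𝓝 v.rho) :=
    (by fun_prop : Continuous fun w : ℝ × ℝ × ℝ × ℝ × ℝ => w.2.2.2.2).tendsto _
  have hf : Tendsto (fun w : ℝ × ℝ × ℝ × ℝ × ℝ => w.2.2.1)
      (𝓝 (Δ ^ 2, Δ, v.Φ1, v.Ψ, v.rho)) (𝓝 v.Φ1) :=
    (by fun_prop : Continuous fun w : ℝ × ℝ × ℝ × ℝ × ℝ => w.2.2.1).tendsto _
  have hx : Tendsto (fun w : ℝ × ℝ × ℝ × ℝ × ℝ => w.1)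
      (𝓝 (Δ ^ 2, Δ, v.Φ1, v.Ψ, v.rho)) (𝓝 (Δ ^ 2)) :=
    (by fun_prop : Continuous fun w : ℝ × ℝ × ℝ × ℝ × ℝ => w.1).tendsto _
  by_cases hL : normalizedLMstar (Δ ^ 2) Δ v.Φ1 v.Ψ v.rho = 0
  · have hΔs := eq_deltaStar_of_normalizedLMstar_eq_zero h1 h2 hρ hΔ hL
    -- The intermediate level leaves room both for critical values at nearby correlations and for
    -- the estimation error in `AR`.
    obtain ⟨q', hq1, hq2⟩ := exists_between hq
    refine ⟨0, ?_⟩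
    have hlim : Tendsto (fun w : ℝ × ℝ × ℝ × ℝ × ℝ => q * v.Φ1 / Δ ^ 4 * (w.1 ^ 2 / w.2.2.1))
        (𝓝 (Δ ^ 2, Δ, v.Φ1, v.Ψ, v.rho)) (𝓝 q) := by
      have := (((hx.pow 2).div hf h1.ne').const_mul (q * v.Φ1 / Δ ^ 4))
      rwa [show q * v.Φ1 / Δ ^ 4 * ((Δ ^ 2) ^ 2 / v.Φ1) = q by
        have := h1.ne'
        field_simp] at this
    filter_upwards [hr.eventually (eventually_critVal_le hα hα' habar hρ.le hq1),
      hlim.eventually (lt_mem_nhds hq2), hf.eventually (lt_mem_nhds h1)]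
      with w hw1 hw2 hw3 C _ hC a ha hab
    refine (hw1 a ha).trans (hw2.le.trans ?_)
    have ha2 := ha.2.1.1
    have ha3 : 0 ≤ 1 - a.1 - a.2 := by linarith [ha.2.2]
    have hfirst : q * v.Φ1 / Δ ^ 4 * (w.1 ^ 2 / w.2.2.1) ≤ a.1 * (C * w.1 / √w.2.2.1) ^ 2 := by
      rw [← hΔs] at hab
      have hC2 : 0 < C ^ 2 := by positivity
      have hnn : 0 ≤ C ^ 2 * (w.1 ^ 2 / w.2.2.1) := by positivity
      calc q * v.Φ1 / Δ ^ 4 * (w.1 ^ 2 / w.2.2.1)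
          = q * v.Φ1 / (C ^ 2 * Δ ^ 4) * (C ^ 2 * (w.1 ^ 2 / w.2.2.1)) := by field_simp
        _ ≤ a.1 * (C ^ 2 * (w.1 ^ 2 / w.2.2.1)) := mul_le_mul_of_nonneg_right hab hnn
        _ = a.1 * (C * w.1 / √w.2.2.1) ^ 2 := by
            rw [div_pow, Real.sq_sqrt hw3.le]; ring
    have : 0 ≤ a.2 * (C * w.2.1 / √w.2.2.2.1) ^ 2 := by positivity
    have : 0 ≤ (1 - a.1 - a.2) *
        (C * normalizedLMstar w.1 w.2.1 w.2.2.1 w.2.2.2.1 w.2.2.2.2) ^ 2 := by positivity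
    linarith
  · obtain ⟨M, hM⟩ := exists_critVal_le hα hα' habar
    set l := normalizedLMstar (Δ ^ 2) Δ v.Φ1 v.Ψ v.rho ^ 2 / 2 with hl
    have hl0 : 0 < l := by positivity
    have hbar : 0 < 1 - abar := by linarith
    -- The added `1` gives `|C| ≤ C²`; then the `LM*` term alone is at least `C² (1 - abar) l ≥
    -- |M|`.
    refine ⟨|M| / ((1 - abar) * l) + 1, ?_⟩
    have hlim := (hcont.tendsto.pow 2).eventually (lt_mem_nhds (by linarith :
      l < normalizedLMstar (Δ ^ 2) Δ v.Φ1 v.Ψ v.rho ^ 2))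
    filter_upwards [hlim, hr.abs.eventually (gt_mem_nhds hρ)] with w hw1 hw2 C hN hC a ha _
    refine (hM a ha _ hw2.le).trans ?_
    have ha1 := ha.1.1
    have ha2 := ha.2.1.1
    have ha3 : 1 - abar ≤ 1 - a.1 - a.2 := by linarith [ha.2.2]
    have hCC : |M| / ((1 - abar) * l) ≤ C ^ 2 := by
      have h0 : 0 ≤ |M| / ((1 - abar) * l) := by positivity
      rw [← sq_abs]
      nlinarith
    have hMC : |M| ≤ C ^ 2 * ((1 - abar) * l) := by
      rwa [div_le_iff₀ (by positivity)] at hCC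
    have h3 : C ^ 2 * ((1 - abar) * l) ≤ (1 - a.1 - a.2) *
        (C * normalizedLMstar w.1 w.2.1 w.2.2.1 w.2.2.2.1 w.2.2.2.2) ^ 2 := by
      rw [mul_pow, mul_left_comm]
      have ha4 : 0 ≤ 1 - a.1 - a.2 := hbar.le.trans ha3
      gcongr
    have : 0 ≤ a.1 * (C * w.1 / √w.2.2.1) ^ 2 := by positivity
    have : 0 ≤ a.2 * (C * w.2.1 / √w.2.2.2.1) ^ 2 := by positivity
    linarith [le_abs_self M]

/-- The centered quadratic forms are bounded in probability and `|𝒞|` diverges, so the ratios `Q /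
𝒞` and the estimates lie in the deterministic rejection neighbourhood with probability close to one.
-/
theorem tendstoInProb_indicator_rejectSet {α abar : ℝ} (hα : 0 < α) (hα' : α < 1)
    (habar : abar < 1) {Ω : ℕ → Type*} [∀ n, MeasurableSpace (Ω n)] {P : ∀ n, Measure (Ω n)}
    {K : ℕ → ℕ} {β β₀ : ℝ} {M : ∀ n, IVModel (P n) n (K n) β} {v : VarComp}
    {γhat : ∀ n, Ω n → EuclideanSpace ℝ (Fin 7)} {a : ∀ n, Ω n → ℝ × ℝ} {q : ℝ}
    (h1 : 0 < v.Φ1) (h2 : 0 < v.Ψ)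
    (hcons : TendstoInProb P (fun n ω => ‖γhat n ω - v.gamma‖) 0)
    (hbdd : BoundedInProb P (fun n => (M n).centered β₀))
    (hconc : Tendsto (fun n => |(M n).conc|) atTop atTop) (hΔ : β - β₀ ≠ 0)
    (hρ : |v.rho| < 1) (hq : critMax α abar v.rho < q)
    (ha : ∀ᶠ n in atTop, ∀ ω, a n ω ∈ weightSet abar ∧
      q * v.Φ1 / ((M n).conc ^ 2 * v.deltaStar ^ 4) ≤ (a n ω).1) :
    TendstoInProb P (fun n => Set.indicator ((M n).rejectSet α β₀ (γhat n) (a n)) 1) 1 := by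
  obtain ⟨N, hN⟩ := exists_eventually_critVal_le_stat hα hα' habar h1 h2 hρ hΔ hq
  obtain ⟨η, hη, hball⟩ := Metric.eventually_nhds_iff_ball.1 hN
  intro ε₀ hε₀
  rw [ENNReal.tendsto_nhds_zero]
  intro ε hε
  obtain ⟨δ, hδ0, hδ⟩ : ∃ δ : ℝ, 0 < δ ∧ ENNReal.ofReal δ ≤ ε / 2 := by
    rcases eq_or_ne ε ⊤ with rfl | hne
    · exact ⟨1, one_pos, by simp [ENNReal.top_div]⟩
    · exact ⟨(ε / 2).toReal, ENNReal.toReal_pos (by simpa using hε.ne')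
        (ENNReal.div_ne_top hne (by simp)), ENNReal.ofReal_toReal_le⟩
  obtain ⟨B, hB⟩ := hbdd δ hδ0
  have hγ := (ENNReal.tendsto_nhds_zero.1 (hcons η hη)) (ε / 2) (by simpa using hε.ne')
  filter_upwards [hB, hγ, ha, hconc.eventually_ge_atTop N,
    hconc.eventually_gt_atTop (|B| / η)] with n hBn hγn han hNn hηn
  set C := (M n).conc with hC
  have hC0 : 0 < |C| := lt_of_le_of_lt (by positivity) hηn
  have hCne : C ≠ 0 := abs_pos.1 hC0
  have hBC : |B| < η * |C| := by rwa [div_lt_iff₀' hη] at hηn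
  -- Non-rejection lies in the union of two bad events; monotonicity and subadditivity suffice,
  -- without measurability of the rejection event.
  refine (measure_mono (t := {ω | B < ‖(M n).centered β₀ ω‖} ∪
    {ω | η ≤ |‖γhat n ω - v.gamma‖ - 0|}) fun ω hω => ?_).trans
    ((measure_union_le _ _).trans ((add_le_add (hBn.trans hδ) hγn).trans_eq
      (ENNReal.add_halves ε)))
  by_contra hnot
  rw [Set.mem_union, not_or] at hnot
  have hcent : ‖(M n).centered β₀ ω‖ ≤ B := not_lt.1 hnot.1
  have hgam : ‖γhat n ω - v.gamma‖ < η := by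
    have h3 : ¬ η ≤ |‖γhat n ω - v.gamma‖ - 0| := hnot.2
    have := not_le.1 h3
    rwa [sub_zero, abs_of_nonneg (norm_nonneg _)] at this
  have hQ : ∀ i, |(M n).centered β₀ ω i| < η * |C| := fun i =>
    lt_of_le_of_lt ((PiLp.norm_apply_le _ i).trans (hcent.trans (le_abs_self B))) hBC
  have hg : ∀ i, |γhat n ω i - v.gamma i| < η := fun i =>
    lt_of_le_of_lt (PiLp.norm_apply_le (γhat n ω - v.gamma) i) hgam
  set Q1 := (M n).Q ((M n).res β₀ ω) ((M n).res β₀ ω) with hQ1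
  set Q2 := (M n).Q ((M n).Xv ω) ((M n).res β₀ ω) with hQ2
  have hd : ∀ Q t : ℝ, |Q - t * C| < η * |C| → dist (Q / C) t < η := by
    intro Q t h
    rw [Real.dist_eq, show Q / C - t = (Q - t * C) / C by field_simp, abs_div, div_lt_iff₀ hC0]
    exact h
  have hmem : (Q1 / C, Q2 / C, γhat n ω 0, γhat n ω 3, γhat n ω 6) ∈
      Metric.ball ((β - β₀) ^ 2, β - β₀, v.Φ1, v.Ψ, v.rho) η := by
    simp only [Metric.mem_ball, Prod.dist_eq, max_lt_iff]
    -- Coordinates `0`, `3`, `6` of `γ` are `Φ₁`, `Ψ`, `ρ`.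
    exact ⟨hd _ _ (hQ 0), hd _ _ (hQ 1), hg 0, hg 3, hg 6⟩
  have hrej := hball _ hmem C hNn hCne (a n ω) (han ω).1 (han ω).2
  have hin : ω ∈ (M n).rejectSet α β₀ (γhat n) (a n) := by
    refine hrej.trans_eq ?_
    simp only [IVModel.AR, IVModel.LMstar, IVModel.LM, normalizedLMstar, ← hQ1, ← hQ2,
      mul_div_cancel₀ _ hCne]
    congr 3
    field_simp
  have hω' : ε₀ ≤ |Set.indicator ((M n).rejectSet α β₀ (γhat n) (a n)) 1 ω - (1 : ℝ)| := hω
  rw [Set.indicator_of_mem hin] at hω'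
  simp at hω'
  linarith

end JackknifeCLC

/-! ### The three regimes combined -/

theorem theorem1 (α abar : ℝ) (hα : 0 < α) (hα' : α < 1) (habar : abar < 1) :
    -- (i) weak identification, fixed alternatives; `v` holds the variance components at `β₀`
    (∀ (v : VarComp) (a : ℝ × ℝ) (U : Matrix (Fin 2) (Fin 2) ℝ) (ν : Fin 2 → ℝ),
      0 < v.Φ1 → 0 < v.Ψ → |v.rho| < 1 → a ∈ weightSet abar → IsEigenDecomp a v.rho U ν →
        power (gaussPair 0) (combTest α a v.rho) = α ∧
        IsAdmissibleIn (squareTests U α) gaussPair {θ | θ ≠ 0} (combTest α a v.rho) ∧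
        IsAdmissibleIn (squareTests U α) gaussPair
          {θ | ∃ Δ c : ℝ, Δ ≠ 0 ∧ c ≠ 0 ∧ θ = v.weakMean Δ c} (combTest α a v.rho) ∧
        ∀ φ ∈ squareTests U α, ∃ bbar : ℝ, 0 < bbar ∧ ∀ b : ℝ, 0 < b → b < bbar →
          ∀ θ : ℝ × ℝ, rotate U θ 0 ^ 2 = b * ν 0 → rotate U θ 1 ^ 2 = b * ν 1 →
            power (gaussPair θ) φ ≤ power (gaussPair θ) (combTest α a v.rho)) ∧
    -- (ii) strong identification, local alternatives
    (∀ (ρ : ℝ) (a : ℝ × ℝ), |ρ| < 1 → a ∈ weightSet abar →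
        (IsUMPIn (invariantTests ρ α (flipOrth ρ)) (localLaw ρ) {θ | θ ≠ 0}
            (combTestLocal α a ρ) ↔ a.1 = 0 ∧ a.2 * ρ = 0) ∧
        (PowerDominates (invariantTests ρ α (flipOrth ρ)) (localLaw ρ) {θ | θ ≠ 0}
            (combTestLocal α a ρ) ↔ a.1 = 0 ∧ a.2 * ρ = 0) ∧
        (IsUMPIn (invariantTests ρ α flipBoth) (localLaw ρ) {θ | θ ≠ 0}
            (combTestLocal α a ρ) ↔ a.1 = 0 ∧ a.2 * ρ = 0) ∧
        (IsUMPIn (unbiasedTests ρ α) (localLaw ρ) {θ | θ ≠ 0}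
            (combTestLocal α a ρ) ↔ a.1 = 0 ∧ a.2 * ρ = 0)) ∧
    -- (iii) strong identification, fixed alternatives
    (∀ (Ω : ℕ → Type*) [∀ n, MeasurableSpace (Ω n)] (P : ∀ n, Measure (Ω n))
        [∀ n, IsProbabilityMeasure (P n)] (K : ℕ → ℕ) (β β₀ : ℝ)
        (M : ∀ n, IVModel (P n) n (K n) β) (v : VarComp) (B : Set ℝ)
        (γhat : ∀ n, ℝ → Ω n → EuclideanSpace ℝ (Fin 7)) (a : ∀ n, Ω n → ℝ × ℝ) (q : ℝ),
      VarianceAssumption P v β B γhat → β₀ ∈ B →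
      BoundedInProb P (fun n => (M n).centered β₀) →
      Tendsto (fun n => |(M n).conc|) atTop atTop →
      β - β₀ ≠ 0 →
      |(v.shift (β - β₀)).rho| < 1 →
      critMax α abar (v.shift (β - β₀)).rho < q →
      (∀ᶠ n in atTop, ∀ ω, a n ω ∈ weightSet abar ∧
        q * (v.shift (β - β₀)).Φ1 / ((M n).conc ^ 2 * (v.shift (β - β₀)).deltaStar ^ 4)
          ≤ (a n ω).1) →
      TendstoInProb P
        (fun n => Set.indicator ((M n).rejectSet α β₀ (γhat n β₀) (a n)) 1) 1) := by
  refine ⟨?_, ?_, ?_⟩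
  · intro v a U ν h1 h2 hρ ha h
    refine ⟨power_combTest hα hα' habar ha hρ.le,
      isAdmissibleIn_combTest hα hα' habar ha hρ.le h (dense_compl_singleton 0),
      isAdmissibleIn_combTest hα hα' habar ha hρ.le h (dense_weakMean h1 h2 hρ), fun φ hφ => ?_⟩
    rcases power_eq_or_lt_combTest hα hα' habar ha hρ.le h hφ with heq | ⟨bbar, hb, hlt⟩
    -- With equal power at every mean any positive threshold serves.
    · exact ⟨1, one_pos, fun b _ _ θ _ _ => (heq θ).le⟩
    · exact ⟨bbar, hb, fun b hb0 hbb θ e0 e1 => (hlt b hb0 hbb θ e0 e1).le⟩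
  · intro ρ a hρ ha
    have m1 := combTestLocal_zero_mem_invariantTests_flipOrth hα hα' hρ
    have m2 := combTestLocal_zero_mem_invariantTests_flipBoth hα hα' hρ
    have m3 := combTestLocal_zero_mem_unbiasedTests hα hα' hρ
    refine ⟨⟨fun h => weights_of_powerDominates hα hα' habar ha hρ m1 h.2, fun h => ?_⟩,
      ⟨fun h => weights_of_powerDominates hα hα' habar ha hρ m1 h, fun h => ?_⟩,
      ⟨fun h => weights_of_powerDominates hα hα' habar ha hρ m2 h.2, fun h => ?_⟩,
      ⟨fun h => weights_of_powerDominates hα hα' habar ha hρ m3 h.2, fun h => ?_⟩⟩ <;>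
      rw [combTestLocal_eq h]
    · exact ⟨m1, powerDominates_flipOrth hα hα' hρ⟩
    · exact powerDominates_flipOrth hα hα' hρ
    · exact ⟨m2, powerDominates_flipBoth hα hα' hρ⟩
    · exact ⟨m3, powerDominates_unbiased hα hα' hρ⟩
  · intro Ω _ P _ K β β₀ M v B γhat a q hV hβ₀ hbdd hconc hΔ hρ hq ha
    obtain ⟨c1, hc1, h1⟩ := hV.pos_Φ1
    obtain ⟨c2, hc2, h2⟩ := hV.pos_Ψ
    exact tendstoInProb_indicator_rejectSet hα hα' habar (hc1.trans_le (h1 β₀ hβ₀))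
      (hc2.trans_le (h2 β₀ hβ₀)) (hV.consistent β₀ hβ₀) hbdd hconc hΔ hρ hq ha
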